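/- **Setting.** Let $f_1,\dots,f_n:\mathbb R^d\to\mathbb R$ be convex and differentiable with $L$-Lipschitz gradients ($L>0$), let $f=\frac1n\sum_{i=1}^n f_i$ be $\mu$-strongly convex ($\mu>0$) with minimizer $x^*$, and put $\kappa=L/\mu$. Let $S_i$ be the set of coordinates $v$ with $[f_i'(x)]_v\ne 0$ for some $x$, let $p_v=\frac1n|\{i: v\in S_i\}|$, let $D_i$ be the diagonal matrix with entries $1/p_v$ for $v\in S_i$ and $0$ otherwise, and let $\Delta=\frac1n\max_v|\{i:v\in S_i\}|$. **Algorithm (Asaga).** The shared memory holds $x\in\mathbb R^d$ and $\alpha_1,\dots,\alpha_n\in\mathbb R^d$, initialized to fixed $x_0$ and $\alpha_i^0$ with $\alpha_i^0$ supported on $S_i$. Several cores run concurrently, without locks, the loop: read all coordinates of $x$ and of all the $\alpha_j$ one at a time (an inconsistent read, with result $\hat x,(\hat\alpha_j)_j$); then sample $i$ uniformly in $\{1,\dots,n\}$; then for each $v\in S_i$ perform the shared memory updates $[x]_v\leftarrow[x]_v-\gamma\,[f_i'(\hat x)-\hat\alpha_i+D_i\frac1n\sum_k\hat\alpha_k]_v$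 (an atomic addition) and $[\alpha_i]_v\leftarrow[f_i'(\hat x)]_v$. The interleaving of these elementary operations is arbitrary: at each moment it may depend on the samples drawn so far and on hardware randomness independent of the samples, which are i.i.d. Iterations are labelled "after read": $\hat x_t$ is the value of $x$ returned by the $(t+1)$-st fully completed read, and iteration $t$ is the one which made this read. Almost surely infinitely many reads are completed, and overlaps are bounded by the integer $\tau\ge0$: for all $t$ and $r\ge t+\tau+1$, every coordinate update of iteration $t$ is written to memory before iteration $r$ starts reading. **Theorem.** Suppose $\tau<n/10$, and let the step size be $\gamma=\frac aL$ with $$0<a\le a^*(\tau):=\frac1{32\,(1+\tau\sqrt\Delta)\,\xi(\kappa,\Delta,\tau)},\qquad \xi(\kappa,\Delta,\tau):=\sqrt{1+\frac1{8\kappa}\min\Big\{\frac1{\sqrt\Delta},\tau\Big\}}.$$ Then for all $t\ge0$ the expectation $\mathbb E f(\hat x_t)$ is finite and $$\mathbb E f(\hat x_t)-f(x^*)\le(1-\rho)^t\,\tilde C_0,\qquad \rho=\frac15\min\Big\{\frac1n,\frac a\kappa\Big\},$$ where the constant $\tilde C_0=\frac{60n}{\gamma}\Big(\|x_0-x^*\|^2+\frac1{5L^2}\sum_{i=1}^n\|\alpha_i^0-f_i'(x^*)\|^2\Big)$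 depends neither on $t$ nor on the execution. -/

import Mathlib

noncomputable section

namespace Asaga

/-- The space `ℝ^d` with its Euclidean norm. -/
abbrev Vec (d : ℕ) := EuclideanSpace ℝ (Fin d)

/-! ### The finite-sum problem, its sparsity and the constants -/

section Problem

variable {n d : ℕ}

/-- The finite sum `f = (1/n) ∑ f_i`. -/
def objective (f : Fin n → Vec d → ℝ) (x : Vec d) : ℝ := (1 / (n : ℝ)) * ∑ i, f i x

open Classical in
/-- `S_i` : the coordinates at which the gradient of `h = f_i` can be nonzero. -/
def support (h : Vec d → ℝ) : Finset (Fin d) :=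
  Finset.univ.filter fun v => ∃ x, gradient h x v ≠ 0

/-- The number of indices `i` with `v ∈ S_i`. -/
def degree (f : Fin n → Vec d → ℝ) (v : Fin d) : ℕ :=
  (Finset.univ.filter fun i => v ∈ support (f i)).card

/-- `p_v` : the probability that `v ∈ S_i` when `i` is uniform on the `n` indices. -/
def coordProb (f : Fin n → Vec d → ℝ) (v : Fin d) : ℝ := (degree f v : ℝ) / n

/-- `Δ = Δ_r / n`, where `Δ_r = max_v #{i : v ∈ S_i}`. -/
def sparsity (f : Fin n → Vec d → ℝ) : ℝ := ((Finset.univ.sup (degree f) : ℕ) : ℝ) / n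

/-- The update direction `g(xhat, ahat, i) = f_i'(xhat) - ahat_i + D_i abar`, at a coordinate
`v ∈ S_i` (it is used only there), where `abar = (1/n) ∑_k ahat_k` and `D_i` multiplies the
coordinate `v ∈ S_i` by `1 / p_v`. -/
def direction (f : Fin n → Vec d → ℝ) (xhat : Vec d) (ahat : Fin n → Vec d) (i : Fin n)
    (v : Fin d) : ℝ :=
  gradient (f i) xhat v - ahat i v + (1 / coordProb f v) * ((1 / (n : ℝ)) * ∑ k, ahat k v)

/-- `ξ(κ, Δ, τ)`. -/
def xi (κ Δ τ : ℝ) : ℝ := √(1 + 1 / (8 * κ) * min (1 / √Δ) τ)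

/-- `a^*(τ)`, the bound on the normalized step size. -/
def aStar (κ Δ τ : ℝ) : ℝ := 1 / (32 * (1 + τ * √Δ) * xi κ Δ τ)

/-- The rate factor `ρ(a) = (1/5) min {1/n, a/κ}`. -/
def rate (n : ℕ) (κ a : ℝ) : ℝ := 1 / 5 * min (1 / (n : ℝ)) (a * (1 / κ))

/-- `C_0 = ‖x_0 - x^*‖² + (1/(5L²)) ∑_i ‖α_i^0 - f_i'(x^*)‖²`. -/
def initialError (f : Fin n → Vec d → ℝ) (L : ℝ) (x0 : Vec d) (a0 : Fin n → Vec d)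
    (xstar : Vec d) : ℝ :=
  ‖x0 - xstar‖ ^ 2 + 1 / (5 * L ^ 2) * ∑ i, ‖a0 i - gradient (f i) xstar‖ ^ 2

end Problem

/-! ### The shared-memory machine running the algorithm

Execution is an interleaving of atomic events, numbered `0, 1, 2, …`. Each event is one elementary
operation of one core on (at most) one scalar cell of the shared memory. -/

/-- The scalar cells of the shared memory: `inl v` holds `[x]_v`, `inr (j, v)` holds `[α_j]_v`. -/
abbrev Cell (n d : ℕ) := Fin d ⊕ (Fin n × Fin d)

/-- Contents of the shared memory (or of a local copy of it). -/
abbrev Mem (n d : ℕ) := Cell n d → ℝ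

/-- The vector `x` stored in a memory. -/
def Mem.x {n d : ℕ} (m : Mem n d) : Vec d := WithLp.toLp 2 fun v => m (Sum.inl v)

/-- The vectors `α_j` stored in a memory. -/
def Mem.a {n d : ℕ} (m : Mem n d) (j : Fin n) : Vec d :=
  WithLp.toLp 2 fun v => m (Sum.inr (j, v))

/-- What a core is doing.
* `idle` : between two iterations;
* `reading b copy todo` : the iteration was started by event number `b`; the core is copying the
  shared memory cell by cell into `copy`, and the cells in `todo` are still to be read;
* `writing t i copy todo` : the read was completed as number `t` (counting from `0`), the index `i`
  was sampled, `copy` is the (inconsistent) read, and the cells in `todo` are still to be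
  written. -/
inductive Core (n d : ℕ) where
  | idle : Core n d
  | reading (b : ℕ) (copy : Mem n d) (todo : Finset (Cell n d)) : Core n d
  | writing (t : ℕ) (i : Fin n) (copy : Mem n d) (todo : Finset (Cell n d)) : Core n d

/-- State of the whole machine with `p` cores. The last three fields only record the execution, for
the labels of the iterations: `count` is the number of reads completed so far, and for `t < count`,
`log t` is the value returned by the read number `t`, and `begun t` is the number of the event that
started this iteration. -/
structure State (n d p : ℕ) where
  mem : Mem n d
  core : Fin p → Core n d
  count : ℕ
  log : ℕ → Mem n d
  begun : ℕ → ℕ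

section Machine

variable {n d p : ℕ}

/-- The cells written by an iteration that sampled `i`: `[x]_v` and `[α_i]_v` for `v ∈ S_i`. -/
def writeSet (f : Fin n → Vec d → ℝ) (i : Fin n) : Finset (Cell n d) :=
  (support (f i)).disjSum ({i} ×ˢ support (f i))

/-- The new content of a cell when an iteration with sample `i` and read `copy` writes to it:
`[x]_v ← [x]_v - γ [g]_v` and `[α_i]_v ← [f_i'(xhat)]_v`. -/
def newValue (f : Fin n → Vec d → ℝ) (γ : ℝ) (i : Fin n) (copy m : Mem n d) : Cell n d → ℝ
  | Sum.inl v => m (Sum.inl v) - γ * direction f copy.x copy.a i v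
  | Sum.inr (_, v) => gradient (f i) copy.x v

/-- Event number `k` : the core `c` performs an operation; `e` is the cell it operates on, if this
operation is a read or a write.
* An idle core starts an iteration.
* A reading core reads one cell that it has not read yet; once all cells are read, the read is
  complete: it receives the current value `t` of the counter as its label, the counter is
  incremented, and the index `tape t` is sampled.
* A writing core writes (atomically) one cell that it has not written yet; once all of its writes
  are done, it becomes idle.
If the event asks for a cell that is not to be read or written, while others are, nothing
happens. -/
def step (f : Fin n → Vec d → ℝ) (γ : ℝ) (tape : ℕ → Fin n) (k : ℕ) (c : Fin p) (e : Cell n d)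
    (s : State n d p) : State n d p :=
  match s.core c with
  | Core.idle =>
      { s with core := Function.update s.core c (Core.reading k 0 Finset.univ) }
  | Core.reading b copy todo =>
      if e ∈ todo then
        { s with
          core := Function.update s.core c
            (Core.reading b (Function.update copy e (s.mem e)) (todo.erase e)) }
      else if todo = ∅ then
        { s with
          core := Function.update s.core c
            (Core.writing s.count (tape s.count) copy (writeSet f (tape s.count)))
          count := s.count + 1
          log := Function.update s.log s.count copy
          begun := Function.update s.begun s.count b }
      else s
  | Core.writing t i copy todo =>
      if e ∈ todo then
        { s with
          mem := Function.update s.mem e (newValue f γ i copy s.mem e)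
          core := Function.update s.core c (Core.writing t i copy (todo.erase e)) }
      else if todo = ∅ then
        { s with core := Function.update s.core c Core.idle }
      else s

/-- The initial state: the shared variables are `x0` and `a0`, and all cores are idle. -/
def initialState (p : ℕ) (x0 : Vec d) (a0 : Fin n → Vec d) : State n d p where
  mem := Sum.elim (fun v => x0 v) (fun jv => a0 jv.1 jv.2)
  core := fun _ => Core.idle
  count := 0
  log := fun _ => 0
  begun := fun _ => 0

/-- A scheduler decides about each event (which core operates, and on which cell) from the number of
the event and from the list of the indices sampled before it. -/
abbrev Scheduler (n d p : ℕ) := ℕ → List (Fin n) → Fin p × Cell n d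

/-- The state of the machine before event number `k`, for the scheduler `sched` and the samples
`tape 0, tape 1, …`. -/
def run (f : Fin n → Vec d → ℝ) (γ : ℝ) (x0 : Vec d) (a0 : Fin n → Vec d)
    (sched : Scheduler n d p) (tape : ℕ → Fin n) : ℕ → State n d p
  | 0 => initialState p x0 a0
  | k + 1 =>
      let s := run f γ x0 a0 sched tape k
      let ev := sched k ((List.range s.count).map tape)
      step f γ tape k ev.1 ev.2 s

/-- In the execution `R`, every read number `t` is completed at some point. -/
def Unending (R : ℕ → State n d p) : Prop := ∀ t, ∃ k, t < (R k).count

/-- Before event `k` of the execution `R`, iteration `t` has completed its read, but some coordinate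
of its update is not yet written to memory. -/
def Unfinished (R : ℕ → State n d p) (t k : ℕ) : Prop :=
  ∃ c i copy todo, (R k).core c = Core.writing t i copy todo ∧ todo.Nonempty

/-- Bounded overlaps: if `r ≥ t + τ + 1`, then every coordinate update from iteration `t` is written
to memory before iteration `r` starts. -/
def BoundedOverlaps (τ : ℕ) (R : ℕ → State n d p) : Prop :=
  ∀ t r k l, t + τ + 1 ≤ r → r < (R l).count → Unfinished R t k → k ≤ (R l).begun r

/-- The inconsistent-read iterate `xhat_t` : the value of `x` returned by the `(t+1)`-st fully
completed read of the execution `R`. -/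
def readIterate (R : ℕ → State n d p) (t : ℕ) : Vec d :=
  ((R (sInf {k | t < (R k).count})).log t).x

end Machine

end Asaga

end

/-! Fix the hardware randomness. Iterations are labelled when their read completes, and the sample
is drawn only then, so read `t` is a function of the samples before `t`, and sample `t` is uniform
given that read. Averaged over this sample, the sparse update `g_t` equals the full gradient at
`x̂_t`: the factor `1 / p_v` compensates for the indices that do not touch `v`.

The analysis follows the virtual iterate `x_t = x_0 - γ ∑_{u<t} g_u`. In the expansion of `‖x_{t+1}
- x*‖²`, strong convexity at `x̂_t` gives a contraction by `1 - γμ/2` and a gain `-2γ e_t`, where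
`e_t` is the mean suboptimality of `x̂_t` (`AsyncProcess.meanSqDist_succ_le`). The price is the
second moment of `g_t`, and terms in `x̂_t - x_t`, which is made of coordinates of updates `g_u`
with `t - τ ≤ u < t`. Sparsity keeps these terms small: `g_u` is independent of sample `t`, whose
support contains a given coordinate with probability at most `Δ`, so different updates are
orthogonal up to a factor `√Δ` (`AsyncProcess.mean_sum_abs_mul_le`).

The second moment of `g_t` is controlled by `e_t`, by the past `e_u` with weights decaying like `(1
- 1/n)^(t-u)` up to delays, and by the initial memory (`AsyncProcess.secondMoment_le`), because
`α_j` holds an old gradient that survives only while `j` is not sampled. After multiplication by `(1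
- ρ)^(-t)` and summation over `t`, the delays become convolutions bounded in weighted `ℓ¹`; the step
size makes their total smaller than the gain, and every single `e_t` is bounded by the sum
(`recursion_bound`).

Two bridges lead to the machine. Invariants of the shared memory show that its reads have the
structure `StructuredAt` (`IsExecution.structuredAt`). Finitely many samples matter at a time and
each value of them has positive probability, independently of the hardware; so almost sure
properties along the actual samples hold for almost all hardware along all samples, and the
expectation is an iterated mean (`ae_forall_firstSamples`, `integral_eq_integral_tapeMean`). -/

namespace Asaga

open Finset

/-! ### Inequalities for convex functions with Lipschitz gradient. -/

section Convex
variable {E : Type*} [NormedAddCommGroup E] [InnerProductSpace ℝ E] [CompleteSpace E]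

theorem hasDerivAt_comp_line {h : E → ℝ} (hd : Differentiable ℝ h) (x d : E) (s : ℝ) :
    HasDerivAt (fun s : ℝ => h (x + s • d)) (inner ℝ (gradient h (x + s • d)) d) s := by
  have h1 : HasDerivAt (fun s : ℝ => x + s • d) d s := by
    simpa using ((hasDerivAt_id s).smul_const d).const_add x
  have h2 := ((hd (x + s • d)).hasGradientAt).hasFDerivAt
  have h3 := h2.comp_hasDerivAt s h1
  rwa [InnerProductSpace.toDual_apply_apply] at h3

theorem gradient_inequality {h : E → ℝ} (hd : Differentiable ℝ h)
    (hc : ConvexOn ℝ Set.univ h) (x y : E) :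
    h x + inner ℝ (gradient h x) (y - x) ≤ h y := by
  have hc' : ConvexOn ℝ Set.univ (fun s : ℝ => h (x + s • (y - x))) := by
    have := hc.comp_affineMap (AffineMap.lineMap x y : ℝ →ᵃ[ℝ] E)
    simpa [Function.comp_def, AffineMap.lineMap_apply, add_comm] using this
  have := hc'.le_slope_of_hasDerivAt (x := 0) (y := 1) trivial trivial one_pos
    (hasDerivAt_comp_line hd x (y - x) 0)
  simp only [slope, zero_smul, add_zero, sub_zero, inv_one, one_smul, add_sub_cancel,
    vsub_eq_sub] at this
  linarith

/-- Monotonicity along the segment replaces integration: the difference to the quadratic majorant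
has nonpositive derivative by Cauchy–Schwarz and the Lipschitz bound. -/
theorem descent_inequality {h : E → ℝ} {L : ℝ} (hd : Differentiable ℝ h)
    (hl : ∀ x y, ‖gradient h x - gradient h y‖ ≤ L * ‖x - y‖) (x d : E) :
    h (x + d) ≤ h x + inner ℝ (gradient h x) d + L / 2 * ‖d‖ ^ 2 := by
  have key : AntitoneOn (fun s : ℝ => h (x + s • d) - s * inner ℝ (gradient h x) d
      - L / 2 * ‖d‖ ^ 2 * s ^ 2) (Set.Icc 0 1) := by
    have hder : ∀ s : ℝ, HasDerivAt (fun s : ℝ => h (x + s • d) - s * inner ℝ (gradient h x) d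
        - L / 2 * ‖d‖ ^ 2 * s ^ 2) (inner ℝ (gradient h (x + s • d)) d - inner ℝ (gradient h x) d
          - L / 2 * ‖d‖ ^ 2 * (2 * s)) s := by
      intro s
      have h1 := (hasDerivAt_id s).mul_const (inner ℝ (gradient h x) d)
      have h2 := ((hasDerivAt_id s).pow 2).const_mul (L / 2 * ‖d‖ ^ 2)
      refine (((hasDerivAt_comp_line hd x d s).sub h1).sub h2).congr_deriv ?_
      simp only [id, one_mul, Nat.cast_ofNat, pow_one, mul_one, Nat.add_one_sub_one]
    refine antitoneOn_of_hasDerivWithinAt_nonpos (convex_Icc 0 1)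
      (fun s _ => (hder s).continuousAt.continuousWithinAt)
      (fun s _ => (hder s).hasDerivWithinAt) ?_
    intro s hs
    rw [interior_Icc] at hs
    rw [← inner_sub_left]
    have h1 := real_inner_le_norm (gradient h (x + s • d) - gradient h x) d
    have h2 := hl (x + s • d) x
    rw [add_sub_cancel_left, norm_smul, Real.norm_of_nonneg hs.1.le] at h2
    nlinarith [mul_le_mul_of_nonneg_right h2 (norm_nonneg d)]
  have := key (Set.left_mem_Icc.2 zero_le_one) (Set.right_mem_Icc.2 zero_le_one) zero_le_one
  simp only [one_smul, one_mul, one_pow, mul_one, zero_smul, add_zero, zero_mul, sub_zero, ne_eq,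
    OfNat.ofNat_ne_zero, not_false_eq_true, zero_pow, mul_zero] at this
  linarith

/-- Convex functions with `L`-Lipschitz gradient lie above their tangents, by at least
`1/(2L)` times the squared variation of the gradient. -/
theorem sq_gradient_sub_le {h : E → ℝ} {L : ℝ} (hL : 0 < L) (hd : Differentiable ℝ h)
    (hc : ConvexOn ℝ Set.univ h)
    (hl : ∀ x y, ‖gradient h x - gradient h y‖ ≤ L * ‖x - y‖) (x y : E) :
    ‖gradient h x - gradient h y‖ ^ 2 ≤
      2 * L * (h x - h y - inner ℝ (gradient h y) (x - y)) := by
  set w := gradient h x - gradient h y with hw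
  -- At the point `x - w / L` the tangent at `y` bounds `h` from below and the descent inequality at
  -- `x` bounds it from above; comparing them leaves `‖w‖² / (2L)`.
  have h1 := gradient_inequality hd hc y (x + (-(1 / L)) • w)
  have h2 := descent_inequality hd hl x ((-(1 / L)) • w)
  have h3 : x + (-(1 / L)) • w - y = (x - y) + (-(1 / L)) • w := by abel
  rw [h3, inner_add_right, inner_smul_right] at h1
  rw [norm_smul, inner_smul_right, mul_pow, Real.norm_eq_abs, sq_abs] at h2
  have h4 : inner ℝ (gradient h x) w - inner ℝ (gradient h y) w = ‖w‖ ^ 2 := by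
    rw [← inner_sub_left, ← hw, real_inner_self_eq_norm_sq]
  have h5 : L / 2 * ((-(1 / L)) ^ 2 * ‖w‖ ^ 2) = 1 / L * ‖w‖ ^ 2 / 2 := by field_simp
  have h6 : 1 / L * ‖w‖ ^ 2 / 2 ≤ h x - h y - inner ℝ (gradient h y) (x - y) := by
    rw [h5] at h2
    have : 1 / L * inner ℝ (gradient h x) w - 1 / L * inner ℝ (gradient h y) w
        = 1 / L * ‖w‖ ^ 2 := by rw [← mul_sub, h4]
    linarith
  calc ‖w‖ ^ 2 = 2 * L * (1 / L * ‖w‖ ^ 2 / 2) := by field_simp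
    _ ≤ _ := by gcongr

theorem gradient_half_sq (μ : ℝ) (x : E) :
    HasGradientAt (fun y : E => μ / 2 * ‖y‖ ^ 2) (μ • x) x := by
  rw [hasGradientAt_iff_hasFDerivAt]
  have h1 := ((hasStrictFDerivAt_norm_sq x).hasFDerivAt).const_mul (μ / 2)
  have h2 : InnerProductSpace.toDual ℝ E (μ • x) = (μ / 2) • 2 • (innerSL ℝ) x := by
    ext y
    simp
    ring
  rw [h2]
  exact h1

theorem strong_gradient_inequality {h : E → ℝ} {μ : ℝ} (hd : Differentiable ℝ h)
    (hs : StrongConvexOn Set.univ μ h) (x y : E) :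
    h x + inner ℝ (gradient h x) (y - x) + μ / 2 * ‖y - x‖ ^ 2 ≤ h y := by
  rw [strongConvexOn_iff_convex] at hs
  have hq := gradient_half_sq (E := E) μ
  have hd' : Differentiable ℝ (fun y : E => h y - μ / 2 * ‖y‖ ^ 2) :=
    hd.sub fun x => (hq x).differentiableAt
  have hg : gradient (fun y : E => h y - μ / 2 * ‖y‖ ^ 2) x = gradient h x - μ • x := by
    refine HasGradientAt.gradient ?_
    rw [hasGradientAt_iff_hasFDerivAt, map_sub]
    exact (hd x).hasGradientAt.hasFDerivAt.sub (hq x).hasFDerivAt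
  have h1 := gradient_inequality hd' hs x y
  rw [hg, inner_sub_left, inner_smul_left] at h1
  have h2 : ‖y - x‖ ^ 2 = ‖y‖ ^ 2 - ‖x‖ ^ 2 - 2 * inner ℝ x (y - x) := by
    rw [inner_sub_right, real_inner_self_eq_norm_sq, norm_sub_sq_real, real_inner_comm]; ring
  simp only [conj_trivial] at h1
  rw [h2]
  linarith

end Convex

/-! ### Mean and second moment of one sparse update, for a fixed read. -/

section OneIterate
variable {n d : ℕ}

/-- The update vector `f_i'(xhat) - ahat_i + D_i abar`, restricted to the support of `f_i`. -/
noncomputable def sparseDirection (f : Fin n → Vec d → ℝ) (xhat : Vec d) (ahat : Fin n → Vec d)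
    (i : Fin n) : Vec d :=
  WithLp.toLp 2 fun v => if v ∈ support (f i) then direction f xhat ahat i v else 0

theorem gradient_apply_eq_zero {h : Vec d → ℝ} {v : Fin d} (hv : v ∉ support h) (x : Vec d) :
    gradient h x v = 0 := by
  by_contra hne
  exact hv (by simp only [support, mem_filter, mem_univ, true_and]; exact ⟨x, hne⟩)

/-- This is unbiasedness at one coordinate, `J` being the set of indices whose support contains it.
The correction is added `#J` times, hence contributes exactly the sum of the `α` that was
subtracted. -/
theorem sum_sub_add_mean {ι : Type*} (s J : Finset ι) (hJ : J ⊆ s) (A α : ι → ℝ)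
    (hA : ∀ j ∈ s, j ∉ J → A j = 0) (hα : ∀ j ∈ s, j ∉ J → α j = 0) :
    ∑ j ∈ J, (A j - α j + (1 / (#J : ℝ)) * ∑ k ∈ s, α k) = ∑ j ∈ s, A j := by
  have h1 : ∑ j ∈ s, A j = ∑ j ∈ J, A j := (sum_subset hJ hA).symm
  have h2 : ∑ j ∈ s, α j = ∑ j ∈ J, α j := (sum_subset hJ hα).symm
  rw [h1, h2, sum_add_distrib, sum_sub_distrib, sum_const, nsmul_eq_mul]
  rcases J.eq_empty_or_nonempty with rfl | hne
  · simp
  · have : (#J : ℝ) ≠ 0 := by exact_mod_cast hne.card_pos.ne'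
    field_simp
    ring

/-- As `b` sums to zero, the correction `c` is the mean over `J` of `α - b`, and centering at the
mean does not increase a sum of squares. In the application `b` consists of the gradients at the
minimizer. -/
theorem sum_sq_sub_add_mean_le {ι : Type*} (s J : Finset ι) (hJ : J ⊆ s) (A α b : ι → ℝ)
    (hα : ∀ j ∈ s, j ∉ J → α j = 0) (hb : ∀ j ∈ s, j ∉ J → b j = 0) (hb0 : ∑ j ∈ s, b j = 0) :
    ∑ j ∈ J, (A j - α j + (1 / (#J : ℝ)) * ∑ k ∈ s, α k) ^ 2 ≤
      2 * ∑ j ∈ s, (A j - b j) ^ 2 + 2 * ∑ j ∈ s, (α j - b j) ^ 2 := by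
  set c := (1 / (#J : ℝ)) * ∑ k ∈ s, α k with hc
  have h2 : ∑ j ∈ s, α j = ∑ j ∈ J, α j := (sum_subset hJ hα).symm
  have hb0' : ∑ j ∈ J, b j = 0 := by rw [← hb0]; exact sum_subset hJ hb
  have hcJ : (#J : ℝ) * c = ∑ j ∈ J, (α j - b j) := by
    rw [sum_sub_distrib, hb0', hc, h2, sub_zero]
    rcases J.eq_empty_or_nonempty with rfl | hne
    · simp
    · have : (#J : ℝ) ≠ 0 := by exact_mod_cast hne.card_pos.ne'
      field_simp
  have h3 : ∑ j ∈ J, ((α j - b j) - c) ^ 2 ≤ ∑ j ∈ J, (α j - b j) ^ 2 := by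
    have : ∑ j ∈ J, ((α j - b j) - c) ^ 2
        = ∑ j ∈ J, (α j - b j) ^ 2 - 2 * c * ∑ j ∈ J, (α j - b j) + #J * c ^ 2 := by
      rw [mul_sum, ← nsmul_eq_mul, ← sum_const, ← sum_sub_distrib, ← sum_add_distrib]
      exact sum_congr rfl fun j _ => by ring
    rw [this, ← hcJ]
    have : 0 ≤ (#J : ℝ) * c ^ 2 := by positivity
    linarith
  calc ∑ j ∈ J, (A j - α j + c) ^ 2
      ≤ ∑ j ∈ J, (2 * (A j - b j) ^ 2 + 2 * ((α j - b j) - c) ^ 2) :=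
        sum_le_sum fun j _ => by nlinarith [sq_nonneg ((A j - b j) + ((α j - b j) - c))]
    _ = 2 * ∑ j ∈ J, (A j - b j) ^ 2 + 2 * ∑ j ∈ J, ((α j - b j) - c) ^ 2 := by
        rw [sum_add_distrib, mul_sum, mul_sum]
    _ ≤ 2 * ∑ j ∈ s, (A j - b j) ^ 2 + 2 * ∑ j ∈ s, (α j - b j) ^ 2 := by
        have h4 : ∑ j ∈ J, (A j - b j) ^ 2 ≤ ∑ j ∈ s, (A j - b j) ^ 2 :=
          sum_le_sum_of_subset_of_nonneg hJ fun _ _ _ => sq_nonneg _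
        have h5 : ∑ j ∈ J, (α j - b j) ^ 2 ≤ ∑ j ∈ s, (α j - b j) ^ 2 :=
          sum_le_sum_of_subset_of_nonneg hJ fun _ _ _ => sq_nonneg _
        linarith

variable (f : Fin n → Vec d → ℝ) (xhat : Vec d) (ahat : Fin n → Vec d)

theorem direction_eq (hn : 0 < n) (i : Fin n) (v : Fin d) :
    direction f xhat ahat i v = gradient (f i) xhat v - ahat i v +
      (1 / (#(univ.filter fun j => v ∈ support (f j)) : ℝ)) * ∑ k, ahat k v := by
  have : (n : ℝ) ≠ 0 := by positivity
  simp only [direction, coordProb, degree]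
  congr 1
  rw [← mul_assoc]
  congr 1
  rw [one_div_div]
  field_simp

theorem sum_sparseDirection_apply (hn : 0 < n) (ha : ∀ i v, v ∉ support (f i) → ahat i v = 0)
    (v : Fin d) : ∑ i, sparseDirection f xhat ahat i v = ∑ i, gradient (f i) xhat v := by
  simp only [sparseDirection, direction_eq f xhat ahat hn]
  rw [← sum_filter]
  refine sum_sub_add_mean _ _ (filter_subset _ _) (fun j => gradient (f j) xhat v)
    (fun j => ahat j v) (fun j _ hj => ?_) (fun j _ hj => ?_)
  · exact gradient_apply_eq_zero (by simpa using hj) _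
  · exact ha _ _ (by simpa using hj)

theorem sum_inner_sparseDirection (hn : 0 < n) (ha : ∀ i v, v ∉ support (f i) → ahat i v = 0)
    (y : Vec d) :
    ∑ i, inner ℝ y (sparseDirection f xhat ahat i) = ∑ i, inner ℝ y (gradient (f i) xhat) := by
  rw [← inner_sum, ← inner_sum]
  congr 1
  ext v
  simpa using sum_sparseDirection_apply f xhat ahat hn ha v

theorem sum_norm_sq_sparseDirection_le (hn : 0 < n)
    (ha : ∀ i v, v ∉ support (f i) → ahat i v = 0)
    (xstar : Vec d) (hstar : ∑ i, gradient (f i) xstar = 0) :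
    ∑ i, ‖sparseDirection f xhat ahat i‖ ^ 2 ≤
      2 * ∑ i, ‖gradient (f i) xhat - gradient (f i) xstar‖ ^ 2 +
      2 * ∑ i, ‖ahat i - gradient (f i) xstar‖ ^ 2 := by
  simp only [EuclideanSpace.real_norm_sq_eq]
  rw [sum_comm, sum_comm (s := univ (α := Fin n)), sum_comm (s := univ (α := Fin n)),
    mul_sum, mul_sum, ← sum_add_distrib]
  refine sum_le_sum fun v _ => ?_
  have h0 : ∑ i, sparseDirection f xhat ahat i v ^ 2 =
      ∑ i with v ∈ support (f i), direction f xhat ahat i v ^ 2 := by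
    rw [sum_filter]
    refine sum_congr rfl fun i _ => ?_
    simp only [sparseDirection]
    split_ifs <;> simp
  rw [h0]
  simp only [direction_eq f xhat ahat hn]
  refine sum_sq_sub_add_mean_le _ _ (filter_subset _ _) (fun j => gradient (f j) xhat v)
    (fun j => ahat j v) (fun j => gradient (f j) xstar v) (fun j _ hj => ?_) (fun j _ hj => ?_) ?_
  · exact ha _ _ (by simpa using hj)
  · exact gradient_apply_eq_zero (by simpa using hj) _
  · simpa using congrArg (fun z : Vec d => z v) hstar

/-- Every coordinate lies in at most `nΔ` supports. After division by `n`: a random support sees on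
average at most a fraction `Δ` of a fixed squared norm. -/
theorem sum_support_sq_le (hn : 0 < n) (y : Vec d) :
    ∑ i, ∑ v, (if v ∈ support (f i) then y v ^ 2 else 0) ≤ n * (sparsity f * ‖y‖ ^ 2) := by
  have hn' : (n : ℝ) ≠ 0 := by positivity
  rw [sum_comm, EuclideanSpace.real_norm_sq_eq, ← mul_assoc, sparsity, mul_div_cancel₀ _ hn',
    mul_sum]
  refine sum_le_sum fun v _ => ?_
  rw [← sum_filter, sum_const, nsmul_eq_mul]
  gcongr
  exact le_sup (f := degree f) (mem_univ v)

variable {f}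

theorem hasGradientAt_objective (hdiff : ∀ i, Differentiable ℝ (f i)) (x : Vec d) :
    HasGradientAt (objective f) ((1 / (n : ℝ)) • ∑ i, gradient (f i) x) x := by
  rw [hasGradientAt_iff_hasFDerivAt, map_smulₛₗ, map_sum]
  have h1 := (HasFDerivAt.fun_sum fun i (_ : i ∈ univ) =>
    ((hdiff i x).hasGradientAt).hasFDerivAt).const_mul (1 / (n : ℝ))
  exact h1

theorem sum_gradient_eq_zero (hn : 0 < n) (hdiff : ∀ i, Differentiable ℝ (f i)) {xstar : Vec d}
    (hx : ∀ y, objective f xstar ≤ objective f y) : ∑ i, gradient (f i) xstar = 0 := by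
  have h1 : IsLocalMin (objective f) xstar := Filter.Eventually.of_forall hx
  have h2 := h1.hasFDerivAt_eq_zero (hasGradientAt_objective hdiff xstar).hasFDerivAt
  have h3 : (1 / (n : ℝ)) • ∑ i, gradient (f i) xstar = 0 := 
    (map_eq_zero_iff _ (InnerProductSpace.toDual ℝ (Vec d)).injective).1 h2
  have : (1 / (n : ℝ)) ≠ 0 := by positivity
  exact (smul_eq_zero.1 h3).resolve_left this

theorem sum_sq_gradient_sub_le (hn : 0 < n) {L : ℝ} (hL : 0 < L)
    (hdiff : ∀ i, Differentiable ℝ (f i)) (hconv : ∀ i, ConvexOn ℝ Set.univ (f i))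
    (hlip : ∀ i x y, ‖gradient (f i) x - gradient (f i) y‖ ≤ L * ‖x - y‖) {xstar : Vec d}
    (hx : ∀ y, objective f xstar ≤ objective f y) (x : Vec d) :
    ∑ i, ‖gradient (f i) x - gradient (f i) xstar‖ ^ 2 ≤
      n * (2 * L * (objective f x - objective f xstar)) := by
  have h1 : ∑ i, ‖gradient (f i) x - gradient (f i) xstar‖ ^ 2 ≤
      ∑ i, 2 * L * (f i x - f i xstar - inner ℝ (gradient (f i) xstar) (x - xstar)) :=
    sum_le_sum fun i _ => sq_gradient_sub_le hL (hdiff i) (hconv i) (hlip i) x xstar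
  refine h1.trans (le_of_eq ?_)
  rw [← mul_sum, sum_sub_distrib, sum_sub_distrib, ← sum_inner, sum_gradient_eq_zero hn hdiff hx,
    inner_zero_left, objective, objective]
  have hn' : (n : ℝ) ≠ 0 := by positivity
  field_simp
  ring

theorem strong_convexity_at_minimizer {μ : ℝ} (hdiff : ∀ i, Differentiable ℝ (f i))
    (hs : StrongConvexOn Set.univ μ (objective f)) (x xstar : Vec d) :
    objective f x - objective f xstar + μ / 2 * ‖x - xstar‖ ^ 2 ≤
      1 / n * ∑ i, inner ℝ (x - xstar) (gradient (f i) x) := by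
  have h1 := strong_gradient_inequality
    (fun x => (hasGradientAt_objective hdiff x).differentiableAt) hs x xstar
  rw [(hasGradientAt_objective hdiff x).gradient, inner_smul_left, sum_inner] at h1
  have h2 : ∑ i, inner ℝ (gradient (f i) x) (xstar - x)
      = -∑ i, inner ℝ (x - xstar) (gradient (f i) x) := by
    rw [← sum_neg_distrib]
    refine sum_congr rfl fun i _ => ?_
    rw [real_inner_comm, ← neg_sub x xstar, inner_neg_left]
  rw [h2, norm_sub_rev, conj_trivial] at h1
  linarith

end OneIterate

/-! ### Averages over finitely many independent uniform samples. -/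

section TapeMean
variable {n : ℕ}

/-- The infinite tape that starts with `w` and continues with the constant `j0`. -/
def extendTape (j0 : Fin n) {T : ℕ} (w : Fin T → Fin n) : ℕ → Fin n :=
  fun u => if h : u < T then w ⟨u, h⟩ else j0

theorem update_extendTape (j0 : Fin n) {T : ℕ} (w : Fin T → Fin n) (t : Fin T) (j : Fin n) :
    Function.update (extendTape j0 w) t j = extendTape j0 (Function.update w t j) := by
  funext u
  rcases eq_or_ne u t with rfl | hu
  · simp [extendTape]
  · rw [Function.update_of_ne hu]
    simp only [extendTape]
    split_ifs with h
    · rw [Function.update_of_ne]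
      intro h'
      exact hu (by simp [← h'])
    · rfl

/-- The mean of `φ` over tapes whose first `T` entries are independent and uniform. -/
noncomputable def tapeMean (j0 : Fin n) (T : ℕ) (φ : (ℕ → Fin n) → ℝ) : ℝ :=
  1 / (n : ℝ) ^ T * ∑ w : Fin T → Fin n, φ (extendTape j0 w)

variable {j0 : Fin n} {T : ℕ}

theorem tapeMean_add (φ ψ : (ℕ → Fin n) → ℝ) :
    tapeMean j0 T (fun ω => φ ω + ψ ω) = tapeMean j0 T φ + tapeMean j0 T ψ := by
  simp only [tapeMean, sum_add_distrib, mul_add]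

theorem tapeMean_const_mul (c : ℝ) (φ : (ℕ → Fin n) → ℝ) :
    tapeMean j0 T (fun ω => c * φ ω) = c * tapeMean j0 T φ := by
  simp only [tapeMean, ← mul_sum]
  ring

theorem tapeMean_sub (φ ψ : (ℕ → Fin n) → ℝ) :
    tapeMean j0 T (fun ω => φ ω - ψ ω) = tapeMean j0 T φ - tapeMean j0 T ψ := by
  simp only [tapeMean, sum_sub_distrib, mul_sub]

theorem tapeMean_sum {ι : Type*} (s : Finset ι) (φ : ι → (ℕ → Fin n) → ℝ) :
    tapeMean j0 T (fun ω => ∑ k ∈ s, φ k ω) = ∑ k ∈ s, tapeMean j0 T (φ k) := by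
  simp only [tapeMean, ← mul_sum]
  rw [sum_comm]

theorem tapeMean_mono {φ ψ : (ℕ → Fin n) → ℝ}
    (h : ∀ w : Fin T → Fin n, φ (extendTape j0 w) ≤ ψ (extendTape j0 w)) :
    tapeMean j0 T φ ≤ tapeMean j0 T ψ := by
  simp only [tapeMean]
  gcongr with w
  exact h w

theorem tapeMean_const (c : ℝ) : tapeMean j0 T (fun _ => c) = c := by
  have hn : (n : ℝ) ≠ 0 := by exact_mod_cast (Fin.pos j0).ne'
  simp [tapeMean]
  field_simp

theorem tapeMean_nonneg {φ : (ℕ → Fin n) → ℝ}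
    (h : ∀ w : Fin T → Fin n, 0 ≤ φ (extendTape j0 w)) : 0 ≤ tapeMean j0 T φ := by
  simpa [tapeMean_const] using tapeMean_mono (j0 := j0) (φ := fun _ => 0) h

/-- Exchanging the entry `w t` with `j` is an involution of the pairs `(w, j)`. -/
theorem sum_sum_update {ι κ : Type*} [Fintype ι] [DecidableEq ι] [Fintype κ] (t : ι)
    (ψ : (ι → κ) → ℝ) :
    ∑ w : ι → κ, ∑ j, ψ (Function.update w t j) = Fintype.card κ * ∑ w, ψ w := by
  have h1 : Function.Involutive (fun p : (ι → κ) × κ => (Function.update p.1 t p.2, p.1 t)) := by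
    intro p
    simp
  have h2 := Fintype.sum_equiv h1.toPerm (fun p => ψ (Function.update p.1 t p.2))
    (fun p => ψ p.1) (fun p => rfl)
  rw [Fintype.sum_prod_type, Fintype.sum_prod_type] at h2
  rw [h2]
  simp [mul_sum]

/-- This plays the role of conditioning on all samples but number `t`: what ignores entry `t` is
untouched, the rest is averaged over a uniform index. -/
theorem tapeMean_resample {t : ℕ} (ht : t < T) (φ : (ℕ → Fin n) → ℝ) :
    tapeMean j0 T φ =
      tapeMean j0 T (fun ω => 1 / (n : ℝ) * ∑ j, φ (Function.update ω t j)) := by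
  have hn : (n : ℝ) ≠ 0 := by exact_mod_cast (Fin.pos j0).ne'
  have h1 : ∑ w : Fin T → Fin n, ∑ j, φ (Function.update (extendTape j0 w) t j)
      = n * ∑ w : Fin T → Fin n, φ (extendTape j0 w) := by
    have := sum_sum_update (⟨t, ht⟩ : Fin T) (fun w : Fin T → Fin n => φ (extendTape j0 w))
    rw [Fintype.card_fin] at this
    rw [← this]
    refine sum_congr rfl fun w _ => sum_congr rfl fun j _ => ?_
    rw [← update_extendTape]
  rw [tapeMean_const_mul]
  simp only [tapeMean]
  rw [h1]
  field_simp

/-- `φ` does not depend on the entry number `r` of the tape. -/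
def IgnoresEntry (r : ℕ) (φ : (ℕ → Fin n) → ℝ) : Prop :=
  ∀ ω j, φ (Function.update ω r j) = φ ω

theorem tapeMean_entry_mul {r : ℕ} (hr : r < T) {φ : (ℕ → Fin n) → ℝ} (hφ : IgnoresEntry r φ)
    (h : Fin n → ℝ) :
    tapeMean j0 T (fun ω => h (ω r) * φ ω) = (1 / (n : ℝ) * ∑ j, h j) * tapeMean j0 T φ := by
  rw [tapeMean_resample hr, ← tapeMean_const_mul]
  congr 1
  funext ω
  simp only [Function.update_self, hφ ω, ← sum_mul]
  ring

theorem tapeMean_eq_entry_mul {r : ℕ} (hr : r < T) {φ : (ℕ → Fin n) → ℝ}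
    (hφ : IgnoresEntry r φ) (j : Fin n) :
    tapeMean j0 T (fun ω => (if ω r = j then 1 else 0) * φ ω) = 1 / n * tapeMean j0 T φ := by
  rw [tapeMean_entry_mul hr hφ (fun k => if k = j then 1 else 0)]
  simp

/-- Each entry in `I` avoids `j` with probability `1 - 1/n`, independently of `φ` and of the other
entries, which are integrated out one by one. -/
theorem tapeMean_avoid_mul {I : Finset ℕ} (hI : ∀ r ∈ I, r < T) {φ : (ℕ → Fin n) → ℝ}
    (hφ : ∀ r ∈ I, IgnoresEntry r φ) (j : Fin n) :
    tapeMean j0 T (fun ω => (if ∀ r ∈ I, ω r ≠ j then 1 else 0) * φ ω) =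
      (1 - 1 / (n : ℝ)) ^ #I * tapeMean j0 T φ := by
  have hn : (n : ℝ) ≠ 0 := by exact_mod_cast (Fin.pos j0).ne'
  induction I using Finset.induction_on with
  | empty => simp
  | insert r I hrI ih =>
    rw [card_insert_of_notMem hrI, pow_succ', mul_assoc,
      ← ih (fun s hs => hI s (mem_insert_of_mem hs)) (fun s hs => hφ s (mem_insert_of_mem hs))]
    have h1 : IgnoresEntry r (fun ω => (if ∀ s ∈ I, ω s ≠ j then (1 : ℝ) else 0) * φ ω) := by
      intro ω k
      simp only [hφ r (mem_insert_self r I) ω k]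
      congr 2
      simp only [eq_iff_iff]
      refine forall₂_congr fun s hs => ?_
      rw [Function.update_of_ne (by rintro rfl; exact hrI hs)]
    have h2 := tapeMean_entry_mul (j0 := j0) (hI r (mem_insert_self r I)) h1
      (fun k => if k ≠ j then 1 else 0)
    have h3 : (1 / (n : ℝ) * ∑ k, if k ≠ j then (1 : ℝ) else 0) = 1 - 1 / n := by
      have : ∑ k, (if k ≠ j then (1 : ℝ) else 0) = n - 1 := by
        have h4 : ∀ k, (if k ≠ j then (1 : ℝ) else 0) = 1 - if k = j then 1 else 0 := by
          intro k; by_cases hk : k = j <;> simp [hk]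
        simp [h4, sum_sub_distrib]
      rw [this]
      field_simp
    rw [h3] at h2
    rw [← h2]
    congr 1
    funext ω
    by_cases h5 : ω r ≠ j <;> simp [h5]

end TapeMean

/-! ### Convolutions in exponentially weighted sums. -/

section Recursion

/-- Discrete convolution against a summable weighted kernel is bounded in the weighted norm. -/
theorem sum_weighted_convolution_le {s K : ℝ} (hs : 0 ≤ s) {c e : ℕ → ℝ} (he : ∀ u, 0 ≤ e u)
    (N : ℕ) (hc0 : ∀ k, 0 ≤ c k) (hc : ∑ k ∈ range N, c k * s ^ k ≤ K) :
    ∑ t ∈ range N, s ^ t * ∑ u ∈ range t, c (t - u) * e u ≤ K * ∑ u ∈ range N, s ^ u * e u := by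
  -- Exchange the sums and split `s ^ t = s ^ u * s ^ (t - u)`; with `k = t - u`, the inner sum is
  -- then part of the one bounded by `K`.
  have h1 : ∑ t ∈ range N, s ^ t * ∑ u ∈ range t, c (t - u) * e u =
      ∑ u ∈ range N, s ^ u * e u * ∑ t ∈ range N,
        if u < t then c (t - u) * s ^ (t - u) else 0 := by
    simp only [mul_sum]
    rw [sum_comm (s := range N) (t := range N)]
    refine sum_congr rfl fun t ht => ?_
    have h2 : range t = (range N).filter (fun u => u < t) := by
      ext u; simp only [mem_range, mem_filter] at *; omega
    rw [h2, sum_filter]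
    refine sum_congr rfl fun u _ => ?_
    split_ifs with h
    · obtain ⟨k, rfl⟩ := Nat.exists_eq_add_of_lt h
      rw [show u + k + 1 - u = k + 1 by omega]
      ring
    · simp
  rw [h1, mul_sum]
  refine sum_le_sum fun u hu => ?_
  rw [mul_comm K]
  refine mul_le_mul_of_nonneg_left ?_ (mul_nonneg (pow_nonneg hs u) (he u))
  refine le_trans ?_ hc
  rw [← sum_filter]
  have hinj : Set.InjOn (fun t => t - u) ((range N).filter (fun t => u < t) : Finset ℕ) := by
    intro a ha b hb hab
    simp only [coe_filter, mem_range, Set.mem_ofPred_eq] at ha hb hab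
    omega
  rw [← sum_image (f := fun k => c k * s ^ k) hinj]
  refine sum_le_sum_of_subset_of_nonneg ?_ fun k _ _ => mul_nonneg (hc0 k) (pow_nonneg hs k)
  intro k hk
  simp only [mem_image, mem_filter, mem_range] at hk ⊢
  obtain ⟨a, ⟨ha, _⟩, rfl⟩ := hk
  omega

/-- The subtraction `k - m` is truncated, so the kernel stays equal to `1` during the first `m`
terms, each at most `s ^ m`, and only then decays geometrically. -/
theorem sum_truncated_geometric_le {s r : ℝ} (hs : 1 ≤ s) (hr0 : 0 ≤ r)
    (hrs : r * s < 1) (m N : ℕ) :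
    ∑ k ∈ range N, r ^ (k - m) * s ^ k ≤ s ^ m * (m + 1 / (1 - r * s)) := by
  have hs0 : 0 ≤ s := by linarith
  calc ∑ k ∈ range N, r ^ (k - m) * s ^ k
      ≤ ∑ k ∈ range (m + N), r ^ (k - m) * s ^ k :=
        sum_le_sum_of_subset_of_nonneg (range_mono (by omega)) fun _ _ _ => by positivity
    _ = ∑ k ∈ range m, r ^ (k - m) * s ^ k + ∑ k ∈ range N, s ^ m * (r * s) ^ k := by
        rw [sum_range_add]
        congr 1
        refine sum_congr rfl fun k _ => ?_
        rw [Nat.add_sub_cancel_left, mul_pow, pow_add]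
        ring
    _ ≤ m * s ^ m + s ^ m * (1 / (1 - r * s)) := by
        gcongr
        · calc ∑ k ∈ range m, r ^ (k - m) * s ^ k ≤ ∑ k ∈ range m, s ^ m := by
                refine sum_le_sum fun k hk => ?_
                rw [mem_range] at hk
                rw [Nat.sub_eq_zero_of_le hk.le, pow_zero, one_mul]
                exact pow_le_pow_right₀ hs hk.le
            _ = m * s ^ m := by simp
        · rw [← mul_sum]
          gcongr
          rw [le_div_iff₀ (by linarith), geom_sum_mul_neg]
          linarith [pow_nonneg (mul_nonneg hr0 hs0) N]
    _ = _ := by ring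

end Recursion

/-! ### Solution of the recursion with delays, and the step size condition. -/

section Recursion

/-- The indicator of the possible delays `1, …, τ`. -/
noncomputable def delayKernel (τ k : ℕ) : ℝ := if 1 ≤ k ∧ k ≤ τ then 1 else 0

theorem delayKernel_nonneg (τ k : ℕ) : 0 ≤ delayKernel τ k := by
  unfold delayKernel; split_ifs <;> norm_num

theorem sum_delayKernel_le {s : ℝ} (hs : 1 ≤ s) (τ N : ℕ) :
    ∑ k ∈ range N, delayKernel τ k * s ^ k ≤ τ * s ^ τ := by
  have h1 : ∀ k, delayKernel τ k * s ^ k = if 1 ≤ k ∧ k ≤ τ then s ^ k else 0 := by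
    intro k; unfold delayKernel; split_ifs <;> simp
  simp only [h1]
  rw [← sum_filter]
  calc ∑ k ∈ (range N).filter (fun k => 1 ≤ k ∧ k ≤ τ), s ^ k
      ≤ ∑ k ∈ Icc 1 τ, s ^ k := by
        refine sum_le_sum_of_subset_of_nonneg (fun k hk => ?_) fun _ _ _ => by positivity
        simp only [mem_filter, mem_Icc] at hk ⊢
        exact hk.2
    _ ≤ ∑ k ∈ Icc 1 τ, s ^ τ := sum_le_sum fun k hk => pow_le_pow_right₀ hs (mem_Icc.1 hk).2
    _ = τ * s ^ τ := by simp

/-- Bernoulli's inequality. It keeps the weights bounded over one delay, since delays are short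
compared with `1 / ρ`. -/
theorem inv_one_sub_pow_le {ρ b : ℝ} (hρ1 : ρ < 1) {m : ℕ} (hb : (m : ℝ) * ρ ≤ b)
    (hb1 : b < 1) : (1 / (1 - ρ)) ^ m ≤ 1 / (1 - b) := by
  rw [one_div_pow]
  have h1 := one_add_mul_le_pow (a := -ρ) (by linarith) m
  refine one_div_le_one_div_of_le (by linarith) ?_
  rw [← sub_eq_add_neg] at h1
  linarith

/-- The step size condition makes the delayed second moments a small perturbation. -/
theorem stepsize_bound {κ Δ τ a : ℝ} (hκ : 0 < κ) (hΔ : 0 < Δ) (hτ : 0 ≤ τ) (ha : 0 < a)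
    (ha' : a ≤ aStar κ Δ τ) :
    a * (1 + τ * √Δ) ≤ 1 / 32 ∧
    a * ((1 + τ * √Δ) + 50 / 49 * τ * (√Δ + a / κ * (1 + τ * √Δ))) ≤ 3 / 40 := by
  have hsq : 0 < √Δ := Real.sqrt_pos.2 hΔ
  set C := 1 + τ * √Δ with hC
  have hCpos : 1 ≤ C := by nlinarith
  set m := min (1 / √Δ) τ with hm
  have hm0 : 0 ≤ m := le_min (by positivity) hτ
  have hξ2 : (xi κ Δ τ) ^ 2 = 1 + 1 / (8 * κ) * m := by
    rw [xi, Real.sq_sqrt (by positivity)]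
  have hξ1 : 1 ≤ xi κ Δ τ := by
    rw [xi, Real.one_le_sqrt]
    have : 0 ≤ 1 / (8 * κ) * m := by positivity
    linarith
  set ξ := xi κ Δ τ
  have h1 : a * C * ξ ≤ 1 / 32 := by
    rw [aStar, le_div_iff₀ (by positivity)] at ha'
    linarith
  have h2 : a * C ≤ 1 / 32 := by
    have : a * C * 1 ≤ a * C * ξ := by gcongr
    linarith
  -- If `m = 1 / √Δ`, then `m * C = 1 / √Δ + τ`; if `m = τ`, use `1 ≤ C`.
  have h3 : τ ≤ m * C := by
    rcases min_choice (1 / √Δ) τ with h | h <;> rw [hm, h]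
    · rw [hC, mul_add, mul_one]
      have : 1 / √Δ * (τ * √Δ) = τ := by field_simp
      rw [this]
      have : 0 ≤ 1 / √Δ := by positivity
      linarith
    · nlinarith
  have h4 : m / κ ≤ 8 * ξ ^ 2 := by
    rw [hξ2]
    have : 1 / (8 * κ) * m = m / κ / 8 := by field_simp
    rw [this]; linarith
  -- The factor `ξ` in the step size serves this term alone: it is at most `m / κ * (a * C) ^ 2`,
  -- and `m / κ ≤ 8 * ξ ^ 2` turns it into `8 * (a * C * ξ) ^ 2`.
  have h5 : a * (τ * (a / κ * C)) ≤ 1 / 128 := by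
    calc a * (τ * (a / κ * C)) ≤ a * (m * C * (a / κ * C)) := by gcongr
      _ = m / κ * (a * C) ^ 2 := by ring
      _ ≤ 8 * ξ ^ 2 * (a * C) ^ 2 := by gcongr
      _ = 8 * (a * C * ξ) ^ 2 := by ring
      _ ≤ 8 * (1 / 32) ^ 2 := by gcongr
      _ = 1 / 128 := by norm_num
  refine ⟨h2, ?_⟩
  have h6 : a * (τ * √Δ) ≤ a * C := by gcongr; linarith
  calc a * (C + 50 / 49 * τ * (√Δ + a / κ * C))
      = a * C + 50 / 49 * (a * (τ * √Δ) + a * (τ * (a / κ * C))) := by ring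
    _ ≤ 1 / 32 + 50 / 49 * (1 / 32 + 1 / 128) := by gcongr; linarith
    _ ≤ 3 / 40 := by norm_num

/-- The second moments are controlled by the suboptimalities, in the weighted `ℓ¹` norm. -/
theorem weighted_second_moment_le {n τ T : ℕ} (hn : 0 < n) (hτ : (τ : ℝ) < n / 10) {ρ L H : ℝ}
    (hρ0 : 0 ≤ ρ) (hρ : ρ ≤ 1 / (5 * n)) (hL : 0 ≤ L) (hH : 0 ≤ H) {Q e : ℕ → ℝ}
    (he : ∀ t, 0 ≤ e t)
    (hQ : ∀ t < T, Q t ≤ 4 * L * e t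
      + 4 * L / n * ∑ u ∈ range t, (1 - 1 / (n : ℝ)) ^ (t - u - (2 * τ + 1)) * e u
      + 2 * (1 - 1 / (n : ℝ)) ^ (t - τ) * H) :
    ∑ t ∈ range T, (1 / (1 - ρ)) ^ t * Q t ≤
      17 * L * ∑ t ∈ range T, (1 / (1 - ρ)) ^ t * e t + 14 / 5 * n * H := by
  have hn1 : (1 : ℝ) ≤ n := by exact_mod_cast hn
  have hρn : ρ * n ≤ 1 / 5 := by
    rw [le_div_iff₀ (by positivity)] at hρ; linarith
  have hρ1 : ρ ≤ 1 / 5 := by nlinarith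
  set q := 1 - ρ with hq
  set s := 1 / q with hs
  have hq0 : 0 < q := by linarith
  have hs1 : 1 ≤ s := by rw [hs, le_div_iff₀ hq0]; linarith
  set r := 1 - 1 / (n : ℝ) with hr
  have hr0 : 0 ≤ r := by rw [hr, sub_nonneg, div_le_one (by positivity)]; exact hn1
  have hsq : s * q = 1 := by rw [hs]; field_simp
  have hgap : 4 / (5 * (n : ℝ)) ≤ 1 - r * s := by
    have h1 : 1 - r * s = s * (q - r) := by linear_combination -hsq
    have h2 : 4 / (5 * (n : ℝ)) ≤ q - r := by
      have : 4 / (5 * (n : ℝ)) = 1 / n - 1 / (5 * n) := by field_simp; norm_num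
      rw [hq, hr, this]; linarith
    have h3 : 0 ≤ 4 / (5 * (n : ℝ)) := by positivity
    rw [h1]; nlinarith
  have hgap0 : 0 < 4 / (5 * (n : ℝ)) := by positivity
  have hgeo : 1 / (1 - r * s) ≤ 5 * n / 4 := by
    calc 1 / (1 - r * s) ≤ 1 / (4 / (5 * (n : ℝ))) := one_div_le_one_div_of_le hgap0 hgap
      _ = 5 * n / 4 := by rw [one_div_div]
  have hK2 : ∑ k ∈ range T, r ^ (k - (2 * τ + 1)) * s ^ k ≤ 13 / 4 * n := by
    refine (sum_truncated_geometric_le hs1 hr0 (by linarith) _ _).trans ?_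
    -- From `τ < n / 10` and `1 ≤ n` one gets `2τ + 1 ≤ 6n/5`, and `ρ ≤ 1 / (5n)`; below, `49 / 20 =
    -- 6 / 5 + 5 / 4`.
    have h1 : s ^ (2 * τ + 1) ≤ 1 / (1 - 6 / 25) := by
      refine inv_one_sub_pow_le (by linarith) ?_ (by norm_num)
      push_cast
      nlinarith
    have h2 : ((2 * τ + 1 : ℕ) : ℝ) + 1 / (1 - r * s) ≤ 49 / 20 * n := by
      push_cast
      linarith
    calc s ^ (2 * τ + 1) * (((2 * τ + 1 : ℕ) : ℝ) + 1 / (1 - r * s))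
        ≤ 1 / (1 - 6 / 25) * (49 / 20 * n) := by
          have : 0 ≤ 1 / (1 - r * s) := by rw [one_div, inv_nonneg]; linarith
          gcongr
      _ ≤ 13 / 4 * n := by linarith
  have hK3 : ∑ k ∈ range T, r ^ (k - τ) * s ^ k ≤ 7 / 5 * n := by
    refine (sum_truncated_geometric_le hs1 hr0 (by linarith) _ _).trans ?_
    -- Here `τ * ρ ≤ (n / 10) * (1 / (5n)) = 1 / 50`; this is also the source of the factor `50 /
    -- 49` for the delay kernel.
    have h1 : s ^ τ ≤ 1 / (1 - 1 / 50) := by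
      refine inv_one_sub_pow_le (by linarith) ?_ (by norm_num)
      nlinarith
    have h2 : (τ : ℝ) + 1 / (1 - r * s) ≤ 27 / 20 * n := by linarith
    calc s ^ τ * ((τ : ℝ) + 1 / (1 - r * s)) ≤ 1 / (1 - 1 / 50) * (27 / 20 * n) := by
          have : 0 ≤ 1 / (1 - r * s) := by rw [one_div, inv_nonneg]; linarith
          gcongr
      _ ≤ 7 / 5 * n := by linarith
  have hW0 : 0 ≤ ∑ u ∈ range T, s ^ u * e u :=
    sum_nonneg fun u _ => mul_nonneg (by positivity) (he u)
  have hconv := sum_weighted_convolution_le (by linarith : 0 ≤ s)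
    (c := fun k => r ^ (k - (2 * τ + 1))) he T (fun k => pow_nonneg hr0 _) hK2
  calc ∑ t ∈ range T, s ^ t * Q t
      ≤ ∑ t ∈ range T, (4 * L * (s ^ t * e t)
        + 4 * L / n * (s ^ t * ∑ u ∈ range t, r ^ (t - u - (2 * τ + 1)) * e u)
        + 2 * H * (r ^ (t - τ) * s ^ t)) := by
        refine sum_le_sum fun t ht => ?_
        calc s ^ t * Q t ≤ s ^ t * _ :=
              mul_le_mul_of_nonneg_left (hQ t (mem_range.1 ht)) (by positivity)
          _ = _ := by ring
    _ = 4 * L * ∑ t ∈ range T, s ^ t * e t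
        + 4 * L / n * ∑ t ∈ range T, s ^ t * ∑ u ∈ range t, r ^ (t - u - (2 * τ + 1)) * e u
        + 2 * H * ∑ t ∈ range T, r ^ (t - τ) * s ^ t := by
        rw [sum_add_distrib, sum_add_distrib, mul_sum, mul_sum, mul_sum]
    _ ≤ 4 * L * ∑ t ∈ range T, s ^ t * e t
        + 4 * L / n * (13 / 4 * n * ∑ t ∈ range T, s ^ t * e t)
        + 2 * H * (7 / 5 * n) := by gcongr
    _ = _ := by field_simp; ring

/-- The weights `s ^ t` with `s = 1 / (1 - ρ)` absorb the contraction, since `ρ ≤ γμ/2`, so the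
distances telescope. What remains bounds the weighted sum of all `e t`, and each term of this
nonnegative sum gives the rate. -/
theorem recursion_bound {n τ T : ℕ} {L μ a γ Δ H : ℝ} (hn : 0 < n) (hτ : (τ : ℝ) < n / 10)
    (hL : 0 < L) (hμ : 0 < μ) (hΔ : 0 < Δ) (hH : 0 ≤ H) (ha : 0 < a)
    (haStar : a ≤ aStar (L / μ) Δ τ) (hγ : γ = a / L) {A Q e : ℕ → ℝ}
    (hA : ∀ t, 0 ≤ A t) (hQ0 : ∀ t, 0 ≤ Q t) (he : ∀ t, 0 ≤ e t)
    (hrec : ∀ t < T, A (t + 1) ≤ (1 - γ * μ / 2) * A t - 2 * γ * e t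
      + γ ^ 2 * (1 + τ * √Δ) * Q t
      + γ ^ 2 * (√Δ + γ * μ * (1 + τ * √Δ)) * ∑ u ∈ range t, delayKernel τ (t - u) * Q u)
    (hQ : ∀ t < T, Q t ≤ 4 * L * e t
      + 4 * L / n * ∑ u ∈ range t, (1 - 1 / (n : ℝ)) ^ (t - u - (2 * τ + 1)) * e u
      + 2 * (1 - 1 / (n : ℝ)) ^ (t - τ) * H) {t : ℕ} (ht : t < T) :
    e t ≤ (1 - rate n (L / μ) a) ^ t *
      (60 * (n / γ) * (A 0 + 1 / (5 * L ^ 2) * (n * H))) := by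
  have hn1 : (1 : ℝ) ≤ n := by exact_mod_cast hn
  have hγ0 : 0 < γ := by rw [hγ]; positivity
  have hγμ : γ * μ = a / (L / μ) := by rw [hγ]; field_simp
  set ρ := rate n (L / μ) a with hρdef
  have hρ0 : 0 ≤ ρ := by
    rw [hρdef, rate]
    have : 0 ≤ min (1 / (n : ℝ)) (a * (1 / (L / μ))) := le_min (by positivity) (by positivity)
    linarith
  have hρ : ρ ≤ 1 / (5 * n) := by
    have h1 : min (1 / (n : ℝ)) (a * (1 / (L / μ))) ≤ 1 / n := min_le_left _ _
    have h2 : 1 / (5 * (n : ℝ)) = 1 / 5 * (1 / n) := by field_simp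
    rw [hρdef, rate, h2]
    linarith
  have hργ : ρ ≤ γ * μ / 2 := by
    have h1 : min (1 / (n : ℝ)) (a * (1 / (L / μ))) ≤ a * (1 / (L / μ)) := min_le_right _ _
    have h2 : 0 ≤ γ * μ := by positivity
    rw [← div_eq_mul_one_div, ← hγμ] at h1
    rw [hρdef, rate, ← div_eq_mul_one_div a, ← hγμ]
    linarith
  have hρn : ρ * n ≤ 1 / 5 := by
    rw [le_div_iff₀ (by positivity)] at hρ; linarith
  have hρ1 : ρ ≤ 1 / 5 := by nlinarith
  have hW := weighted_second_moment_le hn hτ hρ0 hρ hL.le hH he hQ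
  obtain ⟨hst1, hst2⟩ := stepsize_bound (κ := L / μ) (by positivity) hΔ (Nat.cast_nonneg τ) ha
    haStar
  rw [← hγμ] at hst2
  have hC1 : 1 ≤ 1 + (τ : ℝ) * √Δ := le_add_of_nonneg_right (by positivity)
  have hC2 : 0 ≤ √Δ + γ * μ * (1 + τ * √Δ) := by positivity
  set C1 := 1 + (τ : ℝ) * √Δ
  set C2 := √Δ + γ * μ * C1
  set q := 1 - ρ with hq
  have hq0 : 0 < q := by linarith
  set s := 1 / q with hs
  have hs1 : 1 ≤ s := by rw [hs, le_div_iff₀ hq0]; linarith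
  have hsq : s * q = 1 := by rw [hs]; field_simp
  set We := ∑ t ∈ range T, s ^ t * e t with hWe
  set WQ := ∑ t ∈ range T, s ^ t * Q t with hWQ
  have hWQ0 : 0 ≤ WQ := sum_nonneg fun t _ => mul_nonneg (by positivity) (hQ0 t)
  have hdelay : ∑ t ∈ range T, s ^ t * ∑ u ∈ range t, delayKernel τ (t - u) * Q u ≤
      50 / 49 * τ * WQ := by
    refine sum_weighted_convolution_le (by linarith) hQ0 T (delayKernel_nonneg τ) ?_
    refine (sum_delayKernel_le hs1 τ T).trans ?_
    have h1 : s ^ τ ≤ 1 / (1 - 1 / 50) := by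
      refine inv_one_sub_pow_le (by linarith) ?_ (by norm_num)
      nlinarith
    calc (τ : ℝ) * s ^ τ ≤ τ * (1 / (1 - 1 / 50)) := by gcongr
      _ = 50 / 49 * τ := by ring
  have hstep : ∀ t < T, s ^ (t + 1) * A (t + 1) - s ^ t * A t ≤ s * (-(2 * γ) * (s ^ t * e t)
      + γ ^ 2 * C1 * (s ^ t * Q t)
      + γ ^ 2 * C2 * (s ^ t * ∑ u ∈ range t, delayKernel τ (t - u) * Q u)) := by
    intro t ht
    have h1 := mul_le_mul_of_nonneg_left (hrec t ht) (by positivity : 0 ≤ s ^ (t + 1))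
    have h2 : s * (1 - γ * μ / 2) ≤ 1 := by
      rw [← hsq]; gcongr; linarith
    have h3 : s ^ (t + 1) * ((1 - γ * μ / 2) * A t) ≤ s ^ t * A t := by
      calc s ^ (t + 1) * ((1 - γ * μ / 2) * A t)
          = s * (1 - γ * μ / 2) * (s ^ t * A t) := by ring
        _ ≤ 1 * (s ^ t * A t) := by
          gcongr
          exact mul_nonneg (by positivity) (hA t)
        _ = _ := one_mul _
    have h4 : s ^ (t + 1) = s * s ^ t := pow_succ' s t
    rw [h4] at h1 h3 ⊢
    linarith
  have htel : 0 - A 0 ≤ s * (-(2 * γ) * We + γ ^ 2 * C1 * WQ + γ ^ 2 * C2 * (50 / 49 * τ * WQ)) := by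
    calc 0 - A 0 ≤ s ^ T * A T - s ^ 0 * A 0 := by
          rw [pow_zero, one_mul]
          have : 0 ≤ s ^ T * A T := mul_nonneg (by positivity) (hA T)
          linarith
      _ = ∑ t ∈ range T, (s ^ (t + 1) * A (t + 1) - s ^ t * A t) :=
          (sum_range_sub (fun t => s ^ t * A t) T).symm
      _ ≤ ∑ t ∈ range T, s * (-(2 * γ) * (s ^ t * e t) + γ ^ 2 * C1 * (s ^ t * Q t)
          + γ ^ 2 * C2 * (s ^ t * ∑ u ∈ range t, delayKernel τ (t - u) * Q u)) :=
          sum_le_sum fun t ht => hstep t (mem_range.1 ht)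
      _ = s * (-(2 * γ) * We + γ ^ 2 * C1 * WQ
          + γ ^ 2 * C2 * ∑ t ∈ range T, s ^ t * ∑ u ∈ range t, delayKernel τ (t - u) * Q u) := by
          rw [← mul_sum, sum_add_distrib, sum_add_distrib, ← mul_sum, ← mul_sum, ← mul_sum]
      _ ≤ _ := by gcongr
  have hmain : 2 * γ * We ≤ A 0 + γ ^ 2 * (C1 + 50 / 49 * τ * C2) * WQ := by
    have h1 := mul_le_mul_of_nonneg_left htel hq0.le
    rw [← mul_assoc, mul_comm q s, hsq, one_mul] at h1
    have h2 : q * A 0 ≤ 1 * A 0 := mul_le_mul_of_nonneg_right (by linarith) (hA 0)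
    linarith
  have hpert : γ ^ 2 * (C1 + 50 / 49 * τ * C2) * WQ ≤
      γ * (3 / 40) * (17 * We + 14 / 5 * n * H / L) := by
    calc γ ^ 2 * (C1 + 50 / 49 * τ * C2) * WQ
        = γ * (a * (C1 + 50 / 49 * τ * C2)) * (WQ / L) := by
          rw [hγ]; field_simp
      _ ≤ γ * (3 / 40) * (WQ / L) := by gcongr
      _ ≤ γ * (3 / 40) * ((17 * L * We + 14 / 5 * n * H) / L) := by gcongr
      _ = _ := by field_simp
  have hWe_le : We ≤ 60 * (n / γ) * (A 0 + 1 / (5 * L ^ 2) * (n * H)) := by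
    -- The perturbation uses up `3 / 40 * 17 = 51 / 40` of the gain `2`, so more than half of `γ *
    -- We` is left.
    have h1 : γ * We ≤ 2 * A 0 + γ * (1 / 2) * (n * H / L) := by
      have h2 : 14 / 5 * n * H / L = 14 / 5 * (n * H / L) := by ring
      have h3 : 0 ≤ γ * (n * H / L) := by positivity
      have h4 : 0 ≤ A 0 := hA 0
      rw [h2] at hpert
      linarith
    have h2 : γ * L ≤ 1 / 32 := by
      have : γ * L = a := by rw [hγ]; field_simp
      rw [this]
      exact (le_mul_of_one_le_right ha.le hC1).trans hst1
    have h3 : γ * (1 / 2) * (n * H / L) ≤ 12 * n * (n * H) / L ^ 2 := by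
      have h4 : γ * (1 / 2) * (n * H / L) = (γ * L) * (1 / 2) * (n * H / L ^ 2) := by field_simp
      have h5 : 12 * n * (n * H) / L ^ 2 = 12 * n * (n * H / L ^ 2) := by ring
      rw [h4, h5]
      gcongr <;> linarith
    have h4 : 2 * A 0 ≤ 60 * n * A 0 := by
      have := hA 0
      gcongr
      linarith
    have h5 : 60 * (n / γ) * (A 0 + 1 / (5 * L ^ 2) * (n * H))
        = (60 * n * A 0 + 12 * n * (n * H) / L ^ 2) / γ := by field_simp; ring
    rw [h5, le_div_iff₀ hγ0]
    linarith
  calc e t = q ^ t * (s ^ t * e t) := by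
        rw [← mul_assoc, ← mul_pow, mul_comm q s, hsq, one_pow, one_mul]
    _ ≤ q ^ t * We := by
        gcongr
        exact single_le_sum (f := fun t => s ^ t * e t)
          (fun u _ => mul_nonneg (by positivity) (he u)) (mem_range.2 ht)
    _ ≤ _ := by gcongr

end Recursion

/-! ### Delayed reads: distance to the virtual iterate and age of the memory. -/

section AsyncReads
variable {n d : ℕ}

/-- The assumptions on the finite-sum problem. -/
structure SmoothProblem (f : Fin n → Vec d → ℝ) (L μ : ℝ) (xstar : Vec d) : Prop where
  L_pos : 0 < L
  μ_pos : 0 < μ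
  diff : ∀ i, Differentiable ℝ (f i)
  conv : ∀ i, ConvexOn ℝ Set.univ (f i)
  lip : ∀ i x y, ‖gradient (f i) x - gradient (f i) y‖ ≤ L * ‖x - y‖
  strong : StrongConvexOn Set.univ μ (objective f)
  minimizer : ∀ y, objective f xstar ≤ objective f y

/-- How the inconsistent read number `t` depends on the previous ones, if overlaps are bounded by
`τ` and the samples are `ω`: its `x` lacks only recent updates, and its `α_j` come from the last
updates with sample `j`, up to delays. -/
def StructuredAt (f : Fin n → Vec d → ℝ) (γ : ℝ) (x0 : Vec d) (a0 : Fin n → Vec d) (τ : ℕ)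
    (ω : ℕ → Fin n) (ℓ : ℕ → Mem n d) (t : ℕ) : Prop :=
  (∀ v, ∃ U ⊆ range t, (∀ u, u + τ < t → v ∈ support (f (ω u)) → u ∈ U) ∧
    (ℓ t).x v = x0 v - γ * ∑ u ∈ U, sparseDirection f (ℓ u).x (ℓ u).a (ω u) v) ∧
  ∀ j v, ((ℓ t).a j v = a0 j v ∧ (v ∈ support (f j) → ∀ r, r + τ < t → ω r ≠ j)) ∨
    ∃ u < t, v ∈ support (f j) ∧ ω u = j ∧ (ℓ t).a j v = gradient (f j) (ℓ u).x v ∧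
      ∀ r, u + τ < r → r + τ < t → ω r ≠ j

/-- A family of reads, indexed by the tape of samples, such that every read depends only on the
previous samples and has the structure of a run with overlaps bounded by `τ`. -/
structure AsyncProcess (f : Fin n → Vec d → ℝ) (γ : ℝ) (x0 : Vec d) (a0 : Fin n → Vec d)
    (τ T : ℕ) (j0 : Fin n) (X : (ℕ → Fin n) → ℕ → Mem n d) : Prop where
  adapted : ∀ ω ω' t, (∀ u < t, ω u = ω' u) → X ω t = X ω' t
  structured : ∀ w : Fin T → Fin n, ∀ t < T,
    StructuredAt f γ x0 a0 τ (extendTape j0 w) (X (extendTape j0 w)) t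

/-- The update vector of iteration `t`. -/
noncomputable def update (f : Fin n → Vec d → ℝ) (X : (ℕ → Fin n) → ℕ → Mem n d) (t : ℕ)
    (ω : ℕ → Fin n) : Vec d :=
  sparseDirection f (X ω t).x (X ω t).a (ω t)

/-- The virtual iterate, which contains exactly the updates of the iterations before `t`. -/
noncomputable def virtualIterate (f : Fin n → Vec d → ℝ) (γ : ℝ) (x0 : Vec d)
    (X : (ℕ → Fin n) → ℕ → Mem n d) (t : ℕ) (ω : ℕ → Fin n) : Vec d :=
  x0 - γ • ∑ u ∈ range t, update f X u ω

/-- The mean squared norm of the update of iteration `t`. -/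
noncomputable def secondMoment (f : Fin n → Vec d → ℝ) (j0 : Fin n) (T : ℕ)
    (X : (ℕ → Fin n) → ℕ → Mem n d) (t : ℕ) : ℝ :=
  tapeMean j0 T fun ω => ‖update f X t ω‖ ^ 2

/-- The mean suboptimality of the read iterate number `t`. -/
noncomputable def meanGap (f : Fin n → Vec d → ℝ) (xstar : Vec d) (j0 : Fin n) (T : ℕ)
    (X : (ℕ → Fin n) → ℕ → Mem n d) (t : ℕ) : ℝ :=
  tapeMean j0 T fun ω => objective f (X ω t).x - objective f xstar

variable {f : Fin n → Vec d → ℝ} {L μ γ : ℝ} {xstar x0 : Vec d} {a0 : Fin n → Vec d}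
  {τ T : ℕ} {j0 : Fin n} {X : (ℕ → Fin n) → ℕ → Mem n d}

theorem sparseDirection_apply_eq_zero {i : Fin n} {xh : Vec d} {ah : Fin n → Vec d} {v : Fin d}
    (hv : v ∉ support (f i)) : sparseDirection f xh ah i v = 0 := by
  simp [sparseDirection, hv]

theorem StructuredAt.apply_a_eq_zero {ω : ℕ → Fin n} {ℓ : ℕ → Mem n d} {t : ℕ}
    (h : StructuredAt f γ x0 a0 τ ω ℓ t) (ha0 : ∀ i v, v ∉ support (f i) → a0 i v = 0)
    {j : Fin n} {v : Fin d} (hv : v ∉ support (f j)) : (ℓ t).a j v = 0 := by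
  rcases h.2 j v with ⟨h1, -⟩ | ⟨u, -, h1, -⟩
  · rw [h1, ha0 j v hv]
  · exact absurd h1 hv

/-- The two vectors differ at `v` by the updates missing from the read. A missing update older than
`τ` vanishes at `v`, and a more recent one has kernel value `1`. -/
theorem StructuredAt.abs_sub_virtual_le {ω : ℕ → Fin n} {t : ℕ}
    (h : StructuredAt f γ x0 a0 τ ω (X ω) t) (hγ : 0 ≤ γ) (v : Fin d) :
    |((X ω t).x - virtualIterate f γ x0 X t ω) v| ≤
      γ * ∑ u ∈ range t, delayKernel τ (t - u) * |update f X u ω v| := by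
  obtain ⟨U, hU, hU', hx⟩ := h.1 v
  have h1 : ((X ω t).x - virtualIterate f γ x0 X t ω) v =
      γ * ∑ u ∈ range t \ U, update f X u ω v := by
    have h2 := sum_sdiff hU (f := fun u => update f X u ω v)
    have h3 : virtualIterate f γ x0 X t ω v = x0 v - γ * ∑ u ∈ range t, update f X u ω v := by
      simp [virtualIterate]
    rw [PiLp.sub_apply, h3, ← h2, hx]
    simp only [update]
    ring
  rw [h1, abs_mul, abs_of_nonneg hγ]
  gcongr
  refine (abs_sum_le_sum_abs _ _).trans ?_
  calc ∑ u ∈ range t \ U, |update f X u ω v|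
      ≤ ∑ u ∈ range t \ U, delayKernel τ (t - u) * |update f X u ω v| := by
        refine sum_le_sum fun u hu => ?_
        rw [mem_sdiff, mem_range] at hu
        by_cases hut : u + τ < t
        · have : v ∉ support (f (ω u)) := fun hv => hu.2 (hU' u hut hv)
          simp [update, sparseDirection_apply_eq_zero this]
        · have : delayKernel τ (t - u) = 1 := by
            rw [delayKernel, if_pos]; omega
          rw [this, one_mul]
    _ ≤ _ := sum_le_sum_of_subset_of_nonneg sdiff_subset fun u _ _ =>
        mul_nonneg (delayKernel_nonneg _ _) (abs_nonneg _)

/-- Different coordinates of the read `α_j` may come from different iterations `u`. The sum over all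
candidates `u` covers every choice, which makes the bound uniform in the coordinate. -/
theorem StructuredAt.norm_sq_a_sub_le {ω : ℕ → Fin n} {ℓ : ℕ → Mem n d} {t : ℕ}
    (h : StructuredAt f γ x0 a0 τ ω ℓ t) (ha0 : ∀ i v, v ∉ support (f i) → a0 i v = 0)
    (x : Vec d) (j : Fin n) :
    ‖(ℓ t).a j - gradient (f j) x‖ ^ 2 ≤
      ∑ u ∈ range t, (if ω u = j then 1 else 0) *
        ((if ∀ r ∈ Ico (u + τ + 1) (t - τ), ω r ≠ j then 1 else 0) *
          ‖gradient (f j) (ℓ u).x - gradient (f j) x‖ ^ 2) +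
      (if ∀ r ∈ range (t - τ), ω r ≠ j then 1 else 0) * ‖a0 j - gradient (f j) x‖ ^ 2 := by
  simp only [EuclideanSpace.real_norm_sq_eq, mul_sum]
  rw [sum_comm, ← sum_add_distrib]
  refine sum_le_sum fun v _ => ?_
  have hterm : ∀ u ∈ range t, (0 : ℝ) ≤ (if ω u = j then 1 else 0) *
        ((if ∀ r ∈ Ico (u + τ + 1) (t - τ), ω r ≠ j then 1 else 0) *
          (gradient (f j) (ℓ u).x - gradient (f j) x) v ^ 2) := by
    intro u _
    split_ifs <;> simp [sq_nonneg]
  have hlast : (0 : ℝ) ≤ (if ∀ r ∈ range (t - τ), ω r ≠ j then 1 else 0) *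
      (a0 j - gradient (f j) x) v ^ 2 := by
    split_ifs <;> simp [sq_nonneg]
  by_cases hv : v ∈ support (f j)
  · rcases h.2 j v with ⟨h1, h2⟩ | ⟨u, hu, -, hωu, h1, h2⟩
    · have h3 : ∀ r ∈ range (t - τ), ω r ≠ j := fun r hr => h2 hv r (by
        rw [mem_range] at hr; omega)
      refine le_add_of_nonneg_of_le (sum_nonneg hterm) ?_
      rw [if_pos h3, one_mul, PiLp.sub_apply, PiLp.sub_apply, h1]
    · refine le_add_of_le_of_nonneg (le_trans ?_ (single_le_sum hterm (mem_range.2 hu))) hlast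
      have h3 : ∀ r ∈ Ico (u + τ + 1) (t - τ), ω r ≠ j := fun r hr => h2 r
        (by rw [mem_Ico] at hr; omega) (by rw [mem_Ico] at hr; omega)
      rw [if_pos hωu, if_pos h3, one_mul, one_mul, PiLp.sub_apply, PiLp.sub_apply, h1]
  · rw [PiLp.sub_apply, h.apply_a_eq_zero ha0 hv, gradient_apply_eq_zero hv, sub_zero,
      zero_pow two_ne_zero]
    exact add_nonneg (sum_nonneg hterm) hlast

theorem AsyncProcess.update_tape (hX : AsyncProcess f γ x0 a0 τ T j0 X) {t r : ℕ} (htr : t ≤ r)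
    (ω : ℕ → Fin n) (j : Fin n) : X (Function.update ω r j) t = X ω t :=
  hX.adapted _ _ _ fun u hu => Function.update_of_ne (by omega) _ _

theorem AsyncProcess.update_update_tape (hX : AsyncProcess f γ x0 a0 τ T j0 X) {u t : ℕ}
    (hut : u < t) (ω : ℕ → Fin n) (j : Fin n) :
    update f X u (Function.update ω t j) = update f X u ω := by
  rw [update, hX.update_tape hut.le, Function.update_of_ne hut.ne, update]

/-- Sparsity makes updates of different iterations nearly orthogonal in mean. -/
theorem AsyncProcess.mean_sum_abs_mul_le (hX : AsyncProcess f γ x0 a0 τ T j0 X)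
    (hΔ : 0 < sparsity f) {u t : ℕ} (hut : u < t) (ht : t < T) :
    tapeMean j0 T (fun ω => ∑ v, |update f X u ω v| * |update f X t ω v|) ≤
      √(sparsity f) / 2 * (secondMoment f j0 T X u + secondMoment f j0 T X t) := by
  have hn : 0 < n := Fin.pos j0
  have hs : 0 < √(sparsity f) := Real.sqrt_pos.2 hΔ
  set s := √(sparsity f) with hsdef
  have hss : s ^ 2 = sparsity f := Real.sq_sqrt hΔ.le
  -- The weighted arithmetic-geometric inequality with weight `s = √Δ`; coordinates outside the
  -- support of sample `t` contribute nothing to the product.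
  have hpt : ∀ ω, ∑ v, |update f X u ω v| * |update f X t ω v| ≤
      1 / (2 * s) * ∑ v, (if v ∈ support (f (ω t)) then update f X u ω v ^ 2 else 0) +
        s / 2 * ‖update f X t ω‖ ^ 2 := by
    intro ω
    rw [EuclideanSpace.real_norm_sq_eq, mul_sum, mul_sum, ← sum_add_distrib]
    refine sum_le_sum fun v _ => ?_
    split_ifs with hv
    · have h1 : 1 / (2 * s) * update f X u ω v ^ 2 + s / 2 * update f X t ω v ^ 2 -
          |update f X u ω v| * |update f X t ω v| =
          1 / (2 * s) * (|update f X u ω v| - s * |update f X t ω v|) ^ 2 := by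
        rw [← sq_abs (update f X u ω v), ← sq_abs (update f X t ω v)]
        field_simp
        ring
      have h2 : 0 ≤ 1 / (2 * s) * (|update f X u ω v| - s * |update f X t ω v|) ^ 2 := by
        positivity
      linarith
    · rw [update, update, sparseDirection_apply_eq_zero hv]
      simp
  -- Resampling entry `t` leaves the update of `u < t` unchanged, while a uniform support contains
  -- each coordinate with probability at most `Δ = s ^ 2`.
  have h1 : tapeMean j0 T
      (fun ω => ∑ v, (if v ∈ support (f (ω t)) then update f X u ω v ^ 2 else 0)) ≤
      s ^ 2 * secondMoment f j0 T X u := by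
    rw [tapeMean_resample ht, secondMoment, ← tapeMean_const_mul]
    refine tapeMean_mono fun w => ?_
    simp only [Function.update_self, hX.update_update_tape hut]
    have := sum_support_sq_le f hn (update f X u (extendTape j0 w))
    rw [hss, one_div, inv_mul_le_iff₀ (by positivity)]
    exact this
  calc tapeMean j0 T (fun ω => ∑ v, |update f X u ω v| * |update f X t ω v|)
      ≤ tapeMean j0 T (fun ω =>
          1 / (2 * s) * ∑ v, (if v ∈ support (f (ω t)) then update f X u ω v ^ 2 else 0) +
          s / 2 * ‖update f X t ω‖ ^ 2) := tapeMean_mono fun w => hpt _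
    _ = 1 / (2 * s) * tapeMean j0 T
          (fun ω => ∑ v, (if v ∈ support (f (ω t)) then update f X u ω v ^ 2 else 0)) +
        s / 2 * secondMoment f j0 T X t := by
        rw [tapeMean_add, tapeMean_const_mul, tapeMean_const_mul, secondMoment]
    _ ≤ 1 / (2 * s) * (s ^ 2 * secondMoment f j0 T X u) + s / 2 * secondMoment f j0 T X t := by
        gcongr
    _ = _ := by field_simp

theorem secondMoment_nonneg (t : ℕ) : 0 ≤ secondMoment f j0 T X t :=
  tapeMean_nonneg fun _ => by positivity

theorem AsyncProcess.mean_sum_abs_mul_le' (hX : AsyncProcess f γ x0 a0 τ T j0 X)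
    (hΔ : 0 < sparsity f) {u w : ℕ} (hu : u < T) (hw : w < T) :
    tapeMean j0 T (fun ω => ∑ v, |update f X u ω v| * |update f X w ω v|) ≤
      (if u = w then secondMoment f j0 T X u else 0) +
      √(sparsity f) / 2 * (secondMoment f j0 T X u + secondMoment f j0 T X w) := by
  rcases lt_trichotomy u w with h | h | h
  · rw [if_neg h.ne, zero_add]
    exact hX.mean_sum_abs_mul_le hΔ h hw
  · subst h
    rw [if_pos rfl]
    have h1 : tapeMean j0 T (fun ω => ∑ v, |update f X u ω v| * |update f X u ω v|) =
        secondMoment f j0 T X u := by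
      rw [secondMoment]
      congr 1
      funext ω
      rw [EuclideanSpace.real_norm_sq_eq]
      exact sum_congr rfl fun v _ => by rw [abs_mul_abs_self, sq]
    rw [h1]
    have := secondMoment_nonneg (f := f) (j0 := j0) (T := T) (X := X) u
    have h2 : 0 ≤ √(sparsity f) / 2 * (secondMoment f j0 T X u + secondMoment f j0 T X u) := by
      positivity
    linarith
  · rw [if_neg h.ne', zero_add, add_comm (secondMoment f j0 T X u)]
    refine le_trans (le_of_eq ?_) (hX.mean_sum_abs_mul_le hΔ h hu)
    congr 1
    funext ω
    exact sum_congr rfl fun v _ => mul_comm _ _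

theorem sum_range_delayKernel_le (τ t : ℕ) : ∑ u ∈ range t, delayKernel τ (t - u) ≤ τ := by
  have h1 : ∑ u ∈ range t, delayKernel τ (t - u) = ∑ k ∈ range t, delayKernel τ (k + 1) := by
    rw [← sum_range_reflect]
    refine sum_congr rfl fun u hu => ?_
    rw [mem_range] at hu
    congr 1
    omega
  have h2 := sum_delayKernel_le (le_refl (1 : ℝ)) τ (t + 1)
  rw [sum_range_succ'] at h2
  simp only [one_pow, mul_one] at h2
  rw [h1]
  linarith [delayKernel_nonneg τ 0]

theorem delayKernel_mul_self (τ k : ℕ) : delayKernel τ k * delayKernel τ k = delayKernel τ k := by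
  unfold delayKernel; split_ifs <;> simp

/-- Only updates with `u < t` are missing from the read, so all products are between different
iterations and each gains the factor `√Δ / 2`; at most `τ` of them count. -/
theorem AsyncProcess.mean_inner_le (hX : AsyncProcess f γ x0 a0 τ T j0 X) (hγ : 0 ≤ γ)
    (hΔ : 0 < sparsity f) {t : ℕ} (ht : t < T) :
    tapeMean j0 T (fun ω => inner ℝ ((X ω t).x - virtualIterate f γ x0 X t ω) (update f X t ω)) ≤
      γ * √(sparsity f) / 2 * (∑ u ∈ range t, delayKernel τ (t - u) * secondMoment f j0 T X u
        + τ * secondMoment f j0 T X t) := by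
  set Q := secondMoment f j0 T X with hQ
  have hQ0 : ∀ t, 0 ≤ Q t := fun t => secondMoment_nonneg t
  calc tapeMean j0 T
        (fun ω => inner ℝ ((X ω t).x - virtualIterate f γ x0 X t ω) (update f X t ω))
      ≤ tapeMean j0 T (fun ω => γ * ∑ u ∈ range t, delayKernel τ (t - u) *
          ∑ v, |update f X u ω v| * |update f X t ω v|) := by
        refine tapeMean_mono fun w => ?_
        set ω := extendTape j0 w
        have h1 := hX.structured w t ht
        rw [PiLp.inner_apply]
        calc ∑ v, inner ℝ (((X ω t).x - virtualIterate f γ x0 X t ω) v) (update f X t ω v)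
            ≤ ∑ v, (γ * ∑ u ∈ range t, delayKernel τ (t - u) * |update f X u ω v|) *
                |update f X t ω v| := by
              refine sum_le_sum fun v _ => ?_
              refine (real_inner_le_norm _ _).trans ?_
              rw [Real.norm_eq_abs, Real.norm_eq_abs]
              gcongr
              exact h1.abs_sub_virtual_le hγ v
          _ = _ := by
              simp only [mul_sum, sum_mul]
              rw [sum_comm]
              refine sum_congr rfl fun u _ => sum_congr rfl fun v _ => by ring
    _ = γ * ∑ u ∈ range t, delayKernel τ (t - u) *
          tapeMean j0 T (fun ω => ∑ v, |update f X u ω v| * |update f X t ω v|) := by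
        rw [tapeMean_const_mul, tapeMean_sum]
        simp only [tapeMean_const_mul]
    _ ≤ γ * ∑ u ∈ range t, delayKernel τ (t - u) * (√(sparsity f) / 2 * (Q u + Q t)) := by
        gcongr with u hu
        · exact delayKernel_nonneg _ _
        · exact hX.mean_sum_abs_mul_le hΔ (mem_range.1 hu) ht
    _ = γ * √(sparsity f) / 2 * (∑ u ∈ range t, delayKernel τ (t - u) * Q u
          + (∑ u ∈ range t, delayKernel τ (t - u)) * Q t) := by
        rw [sum_mul, ← sum_add_distrib, mul_sum, mul_sum]
        refine sum_congr rfl fun u _ => by ring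
    _ ≤ _ := by
        gcongr
        · exact hQ0 t
        · exact sum_range_delayKernel_le τ t

/-- In the expanded square the diagonal gives the `1`, and the products of different updates give `τ
* √Δ`. -/
theorem AsyncProcess.mean_norm_sq_sub_virtual_le (hX : AsyncProcess f γ x0 a0 τ T j0 X)
    (hγ : 0 ≤ γ) (hΔ : 0 < sparsity f) {t : ℕ} (ht : t < T) :
    tapeMean j0 T (fun ω => ‖(X ω t).x - virtualIterate f γ x0 X t ω‖ ^ 2) ≤
      γ ^ 2 * (1 + τ * √(sparsity f)) *
        ∑ u ∈ range t, delayKernel τ (t - u) * secondMoment f j0 T X u := by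
  set Q := secondMoment f j0 T X with hQ
  have hQ0 : ∀ t, 0 ≤ Q t := fun t => secondMoment_nonneg t
  set K : ℕ → ℝ := fun u => delayKernel τ (t - u) with hK
  have hK0 : ∀ u, 0 ≤ K u := fun u => delayKernel_nonneg _ _
  calc tapeMean j0 T (fun ω => ‖(X ω t).x - virtualIterate f γ x0 X t ω‖ ^ 2)
      ≤ tapeMean j0 T (fun ω => γ ^ 2 * ∑ u ∈ range t, ∑ w ∈ range t, K u * K w *
          ∑ v, |update f X u ω v| * |update f X w ω v|) := by
        refine tapeMean_mono fun w => ?_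
        set ω := extendTape j0 w
        have h1 := hX.structured w t ht
        rw [EuclideanSpace.real_norm_sq_eq]
        calc ∑ v, ((X ω t).x - virtualIterate f γ x0 X t ω) v ^ 2
            ≤ ∑ v, (γ * ∑ u ∈ range t, K u * |update f X u ω v|) ^ 2 := by
              refine sum_le_sum fun v _ => ?_
              rw [← sq_abs]
              gcongr
              exact h1.abs_sub_virtual_le hγ v
          _ = ∑ v, γ ^ 2 * ∑ u ∈ range t, ∑ w ∈ range t, K u * K w *
                (|update f X u ω v| * |update f X w ω v|) := by
              refine sum_congr rfl fun v _ => ?_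
              rw [mul_pow, sq (∑ u ∈ range t, _), sum_mul_sum]
              congr 1
              refine sum_congr rfl fun u _ => sum_congr rfl fun w _ => by ring
          _ = _ := by
              rw [← mul_sum, sum_comm]
              congr 1
              refine sum_congr rfl fun u _ => ?_
              rw [sum_comm]
              refine sum_congr rfl fun w _ => ?_
              rw [mul_sum]
    _ = γ ^ 2 * ∑ u ∈ range t, ∑ w ∈ range t, K u * K w *
          tapeMean j0 T (fun ω => ∑ v, |update f X u ω v| * |update f X w ω v|) := by
        rw [tapeMean_const_mul, tapeMean_sum]
        simp only [tapeMean_sum, tapeMean_const_mul]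
    _ ≤ γ ^ 2 * ∑ u ∈ range t, ∑ w ∈ range t, K u * K w *
          ((if u = w then Q u else 0) + √(sparsity f) / 2 * (Q u + Q w)) := by
        gcongr with u hu w hw
        · exact mul_nonneg (hK0 u) (hK0 w)
        · exact hX.mean_sum_abs_mul_le' hΔ ((mem_range.1 hu).trans ht) ((mem_range.1 hw).trans ht)
    _ = γ ^ 2 * (∑ u ∈ range t, K u * Q u +
          √(sparsity f) * ((∑ u ∈ range t, K u) * ∑ u ∈ range t, K u * Q u)) := by
        congr 1
        have h1 : ∑ u ∈ range t, ∑ w ∈ range t, K u * K w * (if u = w then Q u else 0) =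
            ∑ u ∈ range t, K u * Q u := by
          refine sum_congr rfl fun u hu => ?_
          rw [sum_eq_single_of_mem u hu fun w _ hw => by simp [hw.symm]]
          rw [if_pos rfl, delayKernel_mul_self]
        have h2 : ∑ u ∈ range t, ∑ w ∈ range t, K u * K w * (√(sparsity f) / 2 * (Q u + Q w)) =
            √(sparsity f) * ((∑ u ∈ range t, K u) * ∑ u ∈ range t, K u * Q u) := by
          have h3 : ∑ u ∈ range t, ∑ w ∈ range t, K u * K w * (√(sparsity f) / 2 * (Q u + Q w)) =
              √(sparsity f) / 2 * ((∑ u ∈ range t, K u * Q u) * (∑ u ∈ range t, K u) +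
                (∑ u ∈ range t, K u) * ∑ u ∈ range t, K u * Q u) := by
            rw [sum_mul_sum, sum_mul_sum, ← sum_add_distrib, mul_sum]
            refine sum_congr rfl fun u _ => ?_
            rw [← sum_add_distrib, mul_sum]
            refine sum_congr rfl fun w _ => by ring
          rw [h3]; ring
        rw [← h2, ← h1, ← sum_add_distrib]
        refine sum_congr rfl fun u _ => ?_
        rw [← sum_add_distrib]
        refine sum_congr rfl fun w _ => by ring
    _ ≤ γ ^ 2 * (∑ u ∈ range t, K u * Q u +
          √(sparsity f) * (τ * ∑ u ∈ range t, K u * Q u)) := by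
        gcongr
        · exact sum_nonneg fun u _ => mul_nonneg (hK0 u) (hQ0 u)
        · exact sum_range_delayKernel_le τ t
    _ = _ := by ring

end AsyncReads

/-! ### One-step descent, second moments and linear convergence in mean. -/

section Convergence
variable {n d : ℕ} {f : Fin n → Vec d → ℝ} {L μ γ : ℝ} {xstar x0 : Vec d} {a0 : Fin n → Vec d}
  {τ T : ℕ} {j0 : Fin n} {X : (ℕ → Fin n) → ℕ → Mem n d}

/-- The mean squared distance of the virtual iterate to the minimizer. -/
noncomputable def meanSqDist (f : Fin n → Vec d → ℝ) (γ : ℝ) (x0 xstar : Vec d) (j0 : Fin n)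
    (T : ℕ) (X : (ℕ → Fin n) → ℕ → Mem n d) (t : ℕ) : ℝ :=
  tapeMean j0 T fun ω => ‖virtualIterate f γ x0 X t ω - xstar‖ ^ 2

/-- The update is paired with `x̂_t - x*` instead of `x_t - x*`, because it is at `x̂_t` that its
mean is a gradient; the third term corrects for the exchange. -/
theorem norm_sq_virtualIterate_succ (t : ℕ) (ω : ℕ → Fin n) :
    ‖virtualIterate f γ x0 X (t + 1) ω - xstar‖ ^ 2 =
      ‖virtualIterate f γ x0 X t ω - xstar‖ ^ 2
      - 2 * γ * inner ℝ ((X ω t).x - xstar) (update f X t ω)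
      + 2 * γ * inner ℝ ((X ω t).x - virtualIterate f γ x0 X t ω) (update f X t ω)
      + γ ^ 2 * ‖update f X t ω‖ ^ 2 := by
  have h1 : virtualIterate f γ x0 X (t + 1) ω - xstar =
      (virtualIterate f γ x0 X t ω - xstar) - γ • update f X t ω := by
    rw [virtualIterate, virtualIterate, sum_range_succ, smul_add]
    abel
  have h2 : (X ω t).x - xstar = (virtualIterate f γ x0 X t ω - xstar) +
      ((X ω t).x - virtualIterate f γ x0 X t ω) := by abel
  rw [h1, h2, norm_sub_sq_real, inner_add_left, inner_smul_right, norm_smul, mul_pow,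
    Real.norm_eq_abs, sq_abs]
  ring

theorem half_norm_sq_sub_le (x y z : Vec d) :
    1 / 2 * ‖y - z‖ ^ 2 - ‖x - y‖ ^ 2 ≤ ‖x - z‖ ^ 2 := by
  have h1 : ‖y - z‖ ≤ ‖x - y‖ + ‖x - z‖ := by
    rw [norm_sub_rev x y]
    simpa using norm_add_le (y - x) (x - z)
  have h2 : ‖y - z‖ ^ 2 ≤ (‖x - y‖ + ‖x - z‖) ^ 2 := by gcongr
  nlinarith [sq_nonneg (‖x - y‖ - ‖x - z‖)]

/-- Averaging over sample `t` produces the full gradient at `x̂_t`, to which strong convexity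
applies. The resulting distance of `x̂_t` to the minimizer is then traded for half that of the
virtual iterate, up to the reading error. -/
theorem AsyncProcess.le_mean_inner (hX : AsyncProcess f γ x0 a0 τ T j0 X)
    (hf : SmoothProblem f L μ xstar) (ha0 : ∀ i v, v ∉ support (f i) → a0 i v = 0)
    {t : ℕ} (ht : t < T) :
    meanGap f xstar j0 T X t + μ / 2 * (1 / 2 * meanSqDist f γ x0 xstar j0 T X t -
        tapeMean j0 T (fun ω => ‖(X ω t).x - virtualIterate f γ x0 X t ω‖ ^ 2)) ≤
      tapeMean j0 T (fun ω => inner ℝ ((X ω t).x - xstar) (update f X t ω)) := by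
  have hn : 0 < n := Fin.pos j0
  have hμ := hf.μ_pos
  rw [tapeMean_resample (φ := fun ω => inner ℝ ((X ω t).x - xstar) (update f X t ω)) ht]
  rw [meanGap, meanSqDist, ← tapeMean_const_mul (1 / 2), ← tapeMean_sub,
    ← tapeMean_const_mul (μ / 2), ← tapeMean_add]
  refine tapeMean_mono fun w => ?_
  simp only [hX.update_tape le_rfl, update, Function.update_self]
  set ω := extendTape j0 w
  have h0 := hX.structured w t ht
  rw [sum_inner_sparseDirection f _ _ hn fun i v hv => h0.apply_a_eq_zero ha0 hv]
  refine le_trans ?_ (strong_convexity_at_minimizer hf.diff hf.strong (X ω t).x xstar)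
  have h1 := half_norm_sq_sub_le (X ω t).x (virtualIterate f γ x0 X t ω) xstar
  gcongr

theorem AsyncProcess.meanSqDist_succ_le (hX : AsyncProcess f γ x0 a0 τ T j0 X)
    (hf : SmoothProblem f L μ xstar) (ha0 : ∀ i v, v ∉ support (f i) → a0 i v = 0)
    (hγ : 0 ≤ γ) (hΔ : 0 < sparsity f) {t : ℕ} (ht : t < T) :
    meanSqDist f γ x0 xstar j0 T X (t + 1) ≤
      (1 - γ * μ / 2) * meanSqDist f γ x0 xstar j0 T X t - 2 * γ * meanGap f xstar j0 T X t
      + γ ^ 2 * (1 + τ * √(sparsity f)) * secondMoment f j0 T X t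
      + γ ^ 2 * (√(sparsity f) + γ * μ * (1 + τ * √(sparsity f))) *
        ∑ u ∈ range t, delayKernel τ (t - u) * secondMoment f j0 T X u := by
  have hμ := hf.μ_pos
  have h1 : meanSqDist f γ x0 xstar j0 T X (t + 1) = meanSqDist f γ x0 xstar j0 T X t
      - 2 * γ * tapeMean j0 T (fun ω => inner ℝ ((X ω t).x - xstar) (update f X t ω))
      + 2 * γ * tapeMean j0 T
        (fun ω => inner ℝ ((X ω t).x - virtualIterate f γ x0 X t ω) (update f X t ω))
      + γ ^ 2 * secondMoment f j0 T X t := by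
    simp only [meanSqDist, secondMoment, norm_sq_virtualIterate_succ]
    rw [tapeMean_add, tapeMean_add, tapeMean_sub, tapeMean_const_mul, tapeMean_const_mul,
      tapeMean_const_mul]
  have h2 := mul_le_mul_of_nonneg_left (hX.le_mean_inner hf ha0 ht) (by positivity : 0 ≤ 2 * γ)
  have h3 := mul_le_mul_of_nonneg_left (hX.mean_inner_le hγ hΔ ht) (by positivity : 0 ≤ 2 * γ)
  have h4 := mul_le_mul_of_nonneg_left (hX.mean_norm_sq_sub_virtual_le hγ hΔ ht)
    (by positivity : 0 ≤ γ * μ)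
  rw [h1]
  linarith

/-- For the entry to stem from iteration `u`, sample `u` must be `j`, and none of the samples in the
window from `u + τ + 1` to `t - τ - 1` may be. These samples are independent of read `u`, and the
window has `t - u - (2 * τ + 1)` elements: one `τ` for writes out of order, one for writes not yet
visible. -/
theorem AsyncProcess.mean_norm_sq_gradient_sub_le (hX : AsyncProcess f γ x0 a0 τ T j0 X)
    (ha0 : ∀ i v, v ∉ support (f i) → a0 i v = 0) (x : Vec d) {t : ℕ} (ht : t < T) (j : Fin n) :
    tapeMean j0 T (fun ω => ‖(X ω t).a j - gradient (f j) x‖ ^ 2) ≤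
      ∑ u ∈ range t, 1 / n * ((1 - 1 / (n : ℝ)) ^ (t - u - (2 * τ + 1)) *
        tapeMean j0 T (fun ω => ‖gradient (f j) (X ω u).x - gradient (f j) x‖ ^ 2)) +
      (1 - 1 / (n : ℝ)) ^ (t - τ) * ‖a0 j - gradient (f j) x‖ ^ 2 := by
  refine (tapeMean_mono (ψ := fun ω => ∑ u ∈ range t, (if ω u = j then 1 else 0) *
        ((if ∀ r ∈ Ico (u + τ + 1) (t - τ), ω r ≠ j then 1 else 0) *
          ‖gradient (f j) (X ω u).x - gradient (f j) x‖ ^ 2) +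
      (if ∀ r ∈ range (t - τ), ω r ≠ j then 1 else 0) * ‖a0 j - gradient (f j) x‖ ^ 2) fun w =>
    (hX.structured w t ht).norm_sq_a_sub_le ha0 x j).trans (le_of_eq ?_)
  rw [tapeMean_add, tapeMean_sum]
  congr 1
  · refine sum_congr rfl fun u hu => ?_
    rw [mem_range] at hu
    have hig : ∀ r, u ≤ r →
        IgnoresEntry r (fun ω => ‖gradient (f j) (X ω u).x - gradient (f j) x‖ ^ 2) := by
      intro r hr ω k
      simp only [hX.update_tape hr]
    rw [tapeMean_eq_entry_mul (r := u) (by omega)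
      (φ := fun ω => (if ∀ r ∈ Ico (u + τ + 1) (t - τ), ω r ≠ j then 1 else 0) *
          ‖gradient (f j) (X ω u).x - gradient (f j) x‖ ^ 2),
      tapeMean_avoid_mul]
    · congr 3
      rw [Nat.card_Ico]
      omega
    · intro r hr
      rw [mem_Ico] at hr
      omega
    · intro r hr
      rw [mem_Ico] at hr
      exact hig r (by omega)
    · intro ω k
      simp only [hX.update_tape le_rfl]
      congr 2
      simp only [eq_iff_iff]
      refine forall₂_congr fun r hr => ?_
      rw [mem_Ico] at hr
      rw [Function.update_of_ne (by omega)]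
  · rw [tapeMean_avoid_mul (fun r hr => by rw [mem_range] at hr; omega) (fun r _ ω k => rfl),
      tapeMean_const, card_range]

/-- The update splits into the current gradients and the memory, both compared with the gradients at
the minimizer; the squared gradient differences, summed over the indices, cost `2L` times `n` times
a suboptimality. -/
theorem AsyncProcess.secondMoment_le (hX : AsyncProcess f γ x0 a0 τ T j0 X)
    (hf : SmoothProblem f L μ xstar) (ha0 : ∀ i v, v ∉ support (f i) → a0 i v = 0)
    {t : ℕ} (ht : t < T) :
    secondMoment f j0 T X t ≤ 4 * L * meanGap f xstar j0 T X t
      + 4 * L / n * ∑ u ∈ range t, (1 - 1 / (n : ℝ)) ^ (t - u - (2 * τ + 1)) *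
          meanGap f xstar j0 T X u
      + 2 * (1 - 1 / (n : ℝ)) ^ (t - τ) *
          (1 / n * ∑ i, ‖a0 i - gradient (f i) xstar‖ ^ 2) := by
  have hn : 0 < n := Fin.pos j0
  have hn1 : (1 : ℝ) ≤ n := by exact_mod_cast hn
  have hr0 : 0 ≤ 1 - 1 / (n : ℝ) := by
    rw [sub_nonneg, div_le_one (by positivity)]; exact hn1
  have hgrad : ∀ u, ∑ j, tapeMean j0 T
      (fun ω => ‖gradient (f j) (X ω u).x - gradient (f j) xstar‖ ^ 2) ≤
      n * (2 * L * meanGap f xstar j0 T X u) := by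
    intro u
    rw [meanGap, ← tapeMean_sum, ← tapeMean_const_mul, ← tapeMean_const_mul]
    exact tapeMean_mono fun w =>
      sum_sq_gradient_sub_le hn hf.L_pos hf.diff hf.conv hf.lip hf.minimizer _
  have h1 : secondMoment f j0 T X t ≤ 1 / n * (2 * ∑ j, tapeMean j0 T
      (fun ω => ‖gradient (f j) (X ω t).x - gradient (f j) xstar‖ ^ 2) +
      2 * ∑ j, tapeMean j0 T (fun ω => ‖(X ω t).a j - gradient (f j) xstar‖ ^ 2)) := by
    rw [secondMoment, tapeMean_resample ht, ← tapeMean_sum, ← tapeMean_sum,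
      ← tapeMean_const_mul 2, ← tapeMean_const_mul 2, ← tapeMean_add, ← tapeMean_const_mul]
    refine tapeMean_mono fun w => ?_
    simp only [hX.update_tape le_rfl, update, Function.update_self]
    gcongr
    exact sum_norm_sq_sparseDirection_le f _ _ hn
      (fun i v hv => (hX.structured w t ht).apply_a_eq_zero ha0 hv) xstar
      (sum_gradient_eq_zero hn hf.diff hf.minimizer)
  have h2 : ∑ j, tapeMean j0 T (fun ω => ‖(X ω t).a j - gradient (f j) xstar‖ ^ 2) ≤
      ∑ u ∈ range t, (1 - 1 / (n : ℝ)) ^ (t - u - (2 * τ + 1)) *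
        (2 * L * meanGap f xstar j0 T X u) +
      (1 - 1 / (n : ℝ)) ^ (t - τ) * ∑ j, ‖a0 j - gradient (f j) xstar‖ ^ 2 := by
    refine (sum_le_sum fun j _ => hX.mean_norm_sq_gradient_sub_le ha0 xstar ht j).trans ?_
    rw [sum_add_distrib, ← mul_sum, sum_comm]
    gcongr with u hu
    rw [← mul_sum, ← mul_sum]
    calc 1 / (n : ℝ) * ((1 - 1 / (n : ℝ)) ^ (t - u - (2 * τ + 1)) * ∑ j, tapeMean j0 T
          (fun ω => ‖gradient (f j) (X ω u).x - gradient (f j) xstar‖ ^ 2))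
        ≤ 1 / (n : ℝ) * ((1 - 1 / (n : ℝ)) ^ (t - u - (2 * τ + 1)) *
          (n * (2 * L * meanGap f xstar j0 T X u))) := by
          gcongr
          exact hgrad u
      _ = _ := by field_simp
  calc secondMoment f j0 T X t ≤ _ := h1
    _ ≤ 1 / n * (2 * (n * (2 * L * meanGap f xstar j0 T X t)) +
        2 * (∑ u ∈ range t, (1 - 1 / (n : ℝ)) ^ (t - u - (2 * τ + 1)) *
        (2 * L * meanGap f xstar j0 T X u) +
        (1 - 1 / (n : ℝ)) ^ (t - τ) * ∑ j, ‖a0 j - gradient (f j) xstar‖ ^ 2)) := by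
        gcongr
        exact hgrad t
    _ = _ := by
        have h3 : ∑ u ∈ range t, (1 - 1 / (n : ℝ)) ^ (t - u - (2 * τ + 1)) *
            (2 * L * meanGap f xstar j0 T X u) = 2 * L * ∑ u ∈ range t,
            (1 - 1 / (n : ℝ)) ^ (t - u - (2 * τ + 1)) * meanGap f xstar j0 T X u := by
          rw [mul_sum]
          exact sum_congr rfl fun u _ => by ring
        rw [h3]
        have : (n : ℝ) ≠ 0 := by positivity
        generalize (1 - 1 / (n : ℝ)) ^ (t - τ) = b
        generalize ∑ u ∈ range t, (1 - 1 / (n : ℝ)) ^ (t - u - (2 * τ + 1)) *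
          meanGap f xstar j0 T X u = c
        field_simp
        ring

/-- Settles the degenerate case `Δ = 0`, where the weight `√Δ` cannot be divided by: no coordinate
is in any support, so all gradients vanish. -/
theorem objective_eq_of_sparsity_eq_zero (hn : 0 < n) (hdiff : ∀ i, Differentiable ℝ (f i))
    (hΔ : sparsity f = 0) (x y : Vec d) : objective f x = objective f y := by
  have hdeg : ∀ v, degree f v = 0 := by
    intro v
    have hn' : (n : ℝ) ≠ 0 := by positivity
    have h1 : univ.sup (degree f) = 0 := by
      have := (div_eq_zero_iff.1 hΔ).resolve_right hn'
      exact_mod_cast this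
    exact Nat.le_zero.1 (h1 ▸ le_sup (f := degree f) (mem_univ v))
  have hgrad : ∀ i x, gradient (f i) x = 0 := by
    intro i x
    ext v
    refine gradient_apply_eq_zero (fun hv => ?_) x
    have := card_eq_zero.1 (hdeg v)
    exact filter_eq_empty_iff.1 this (mem_univ i) hv
  have hconst : ∀ i, f i x = f i y := by
    intro i
    refine is_const_of_fderiv_eq_zero (𝕜 := ℝ) (hdiff i) (fun z => ?_) x y
    rw [((hdiff i z).hasGradientAt).hasFDerivAt.fderiv, hgrad, map_zero]
  simp only [objective, hconst]

/-- Linear convergence, in mean over the tape, of a process with bounded overlaps. -/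
theorem AsyncProcess.meanGap_le (hX : AsyncProcess f γ x0 a0 τ T j0 X)
    (hf : SmoothProblem f L μ xstar) (ha0 : ∀ i v, v ∉ support (f i) → a0 i v = 0)
    (hτ : (τ : ℝ) < n / 10) {a : ℝ} (ha : 0 < a) (haStar : a ≤ aStar (L / μ) (sparsity f) τ)
    (hγ : γ = a / L) {t : ℕ} (ht : t < T) :
    meanGap f xstar j0 T X t ≤ (1 - rate n (L / μ) a) ^ t *
      (60 * (n / γ) * initialError f L x0 a0 xstar) := by
  have hn : 0 < n := Fin.pos j0
  have hn1 : (1 : ℝ) ≤ n := by exact_mod_cast hn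
  have hL := hf.L_pos
  have hμ := hf.μ_pos
  have hγ0 : 0 < γ := by rw [hγ]; positivity
  have hΔ0 : 0 ≤ sparsity f := div_nonneg (Nat.cast_nonneg _) (Nat.cast_nonneg _)
  have hsum : 0 ≤ ∑ i, ‖a0 i - gradient (f i) xstar‖ ^ 2 := sum_nonneg fun i _ => sq_nonneg _
  rcases hΔ0.eq_or_lt with hΔ | hΔ
  · have h1 : meanGap f xstar j0 T X t = 0 := by
      have h2 : ∀ x, objective f x - objective f xstar = 0 := fun x =>
        sub_eq_zero.2 (objective_eq_of_sparsity_eq_zero hn hf.diff hΔ.symm x xstar)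
      simp only [meanGap, h2, tapeMean_const]
    have h2 : rate n (L / μ) a ≤ 1 := by
      have h3 : min (1 / (n : ℝ)) (a * (1 / (L / μ))) ≤ 1 / n := min_le_left _ _
      have h4 : 1 / (n : ℝ) ≤ 1 := by rw [div_le_one (by positivity)]; exact hn1
      rw [rate]
      linarith
    have h3 : 0 ≤ initialError f L x0 a0 xstar := by
      have : 0 ≤ 1 / (5 * L ^ 2) := by positivity
      exact add_nonneg (sq_nonneg _) (mul_nonneg this hsum)
    have h4 : 0 ≤ 1 - rate n (L / μ) a := by linarith
    have h5 : 0 ≤ 60 * (n / γ) := by positivity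
    rw [h1]
    exact mul_nonneg (pow_nonneg h4 t) (mul_nonneg h5 h3)
  · have h0 : meanSqDist f γ x0 xstar j0 T X 0 = ‖x0 - xstar‖ ^ 2 := by
      simp [meanSqDist, virtualIterate, tapeMean_const]
    have hA : ∀ t, 0 ≤ meanSqDist f γ x0 xstar j0 T X t := fun t =>
      tapeMean_nonneg fun _ => sq_nonneg _
    have he : ∀ t, 0 ≤ meanGap f xstar j0 T X t := fun t =>
      tapeMean_nonneg fun _ => sub_nonneg.2 (hf.minimizer _)
    have hQ0 : ∀ t, 0 ≤ secondMoment f j0 T X t := secondMoment_nonneg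
    have hH : 0 ≤ 1 / (n : ℝ) * ∑ i, ‖a0 i - gradient (f i) xstar‖ ^ 2 :=
      mul_nonneg (by positivity) hsum
    have hrec := fun t (ht : t < T) => hX.meanSqDist_succ_le hf ha0 hγ0.le hΔ ht
    have hQ := fun t (ht : t < T) => hX.secondMoment_le hf ha0 ht
    have h1 := recursion_bound hn hτ hL hμ hΔ hH ha haStar hγ hA hQ0 he hrec hQ ht
    rw [h0] at h1
    have h2 : (n : ℝ) * (1 / n * ∑ i, ‖a0 i - gradient (f i) xstar‖ ^ 2) =
        ∑ i, ‖a0 i - gradient (f i) xstar‖ ^ 2 := by field_simp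
    rw [h2] at h1
    exact h1

end Convergence

/-! ### Executions of the machine and their bookkeeping invariants. -/

section Execution
variable {n d p : ℕ} {f : Fin n → Vec d → ℝ} {γ : ℝ} {x0 : Vec d} {a0 : Fin n → Vec d}
  {tape : ℕ → Fin n} {τ : ℕ}

/-- The effective operations of the machine at event `k`. -/
inductive StepRel (f : Fin n → Vec d → ℝ) (γ : ℝ) (tape : ℕ → Fin n) (k : ℕ)
    (s : State n d p) : State n d p → Prop
  | skip : StepRel f γ tape k s s
  | start (c : Fin p) (h : s.core c = Core.idle) : StepRel f γ tape k s
      { s with core := Function.update s.core c (Core.reading k 0 univ) }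
  | read (c : Fin p) (b : ℕ) (copy : Mem n d) (todo : Finset (Cell n d)) (e : Cell n d)
      (h : s.core c = Core.reading b copy todo) (he : e ∈ todo) : StepRel f γ tape k s
      { s with core := Function.update s.core c
                (Core.reading b (Function.update copy e (s.mem e)) (todo.erase e)) }
  | sample (c : Fin p) (b : ℕ) (copy : Mem n d)
      (h : s.core c = Core.reading b copy ∅) : StepRel f γ tape k s
      { s with
          core := Function.update s.core c
            (Core.writing s.count (tape s.count) copy (writeSet f (tape s.count)))
          count := s.count + 1
          log := Function.update s.log s.count copy
          begun := Function.update s.begun s.count b }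
  | write (c : Fin p) (t : ℕ) (i : Fin n) (copy : Mem n d) (todo : Finset (Cell n d))
      (e : Cell n d) (h : s.core c = Core.writing t i copy todo) (he : e ∈ todo) :
      StepRel f γ tape k s
      { s with
          mem := Function.update s.mem e (newValue f γ i copy s.mem e)
          core := Function.update s.core c (Core.writing t i copy (todo.erase e)) }
  | finish (c : Fin p) (t : ℕ) (i : Fin n) (copy : Mem n d)
      (h : s.core c = Core.writing t i copy ∅) : StepRel f γ tape k s
      { s with core := Function.update s.core c Core.idle }

/-- Passing to the relation forgets the scheduler, so the invariants below hold for every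
interleaving. -/
theorem stepRel_step (k : ℕ) (c : Fin p) (e : Cell n d) (s : State n d p) :
    StepRel f γ tape k s (step f γ tape k c e s) := by
  unfold step
  split
  · next h => exact .start c h
  · next b copy todo h =>
    split_ifs with h1 h2
    · exact .read c b copy todo e h h1
    · subst h2
      exact .sample c b copy h
    · exact .skip
  · next t i copy todo h =>
    split_ifs with h1 h2
    · exact .write c t i copy todo e h h1
    · subst h2
      exact .finish c t i copy h
    · exact .skip

/-- `R` is an execution of the machine, with an arbitrary interleaving of the events. -/
structure IsExecution (f : Fin n → Vec d → ℝ) (γ : ℝ) (x0 : Vec d) (a0 : Fin n → Vec d)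
    (tape : ℕ → Fin n) (R : ℕ → State n d p) : Prop where
  zero : R 0 = initialState p x0 a0
  succ : ∀ k, StepRel f γ tape k (R k) (R (k + 1))

theorem isExecution_run (sched : Scheduler n d p) :
    IsExecution f γ x0 a0 tape (run f γ x0 a0 sched tape) :=
  ⟨rfl, fun k => stepRel_step k _ _ _⟩

/-- A core has still to write the cell `e` on behalf of iteration `u`. -/
def Core.Owes (u : ℕ) (e : Cell n d) : Core n d → Prop
  | .writing t _ _ todo => t = u ∧ e ∈ todo
  | _ => False

/-- Some core has still to write the cell `e` on behalf of iteration `u`. -/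
def Pending (s : State n d p) (u : ℕ) (e : Cell n d) : Prop := ∃ c, (s.core c).Owes u e

theorem Pending.unfinished {R : ℕ → State n d p} {k u : ℕ} {e : Cell n d}
    (h : Pending (R k) u e) : Unfinished R u k := by
  obtain ⟨c, hc⟩ := h
  cases h : (R k).core c with
  | idle => rw [h] at hc; exact hc.elim
  | reading b copy todo => rw [h] at hc; exact hc.elim
  | writing t i copy todo =>
    rw [h] at hc
    obtain ⟨rfl, he⟩ := hc
    exact ⟨c, i, copy, todo, h, e, he⟩

theorem exists_owes_update_iff (core : Fin p → Core n d) (c : Fin p) (new : Core n d) (u : ℕ)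
    (e : Cell n d) : (∃ c', (Function.update core c new c').Owes u e) ↔
      new.Owes u e ∨ ∃ c', c' ≠ c ∧ (core c').Owes u e := by
  rw [Function.exists_update_iff core (p := fun _ x => Core.Owes u e x)]

theorem exists_owes_update_iff_of_not (core : Fin p → Core n d) (c : Fin p) (new : Core n d)
    (u : ℕ) (e : Cell n d) (hc : ¬(core c).Owes u e) :
    (∃ c', (Function.update core c new c').Owes u e) ↔
      new.Owes u e ∨ ∃ c', (core c').Owes u e := by
  rw [exists_owes_update_iff]
  refine or_congr Iff.rfl ⟨fun ⟨c', _, h⟩ => ⟨c', h⟩, fun ⟨c', h⟩ => ⟨c', ?_, h⟩⟩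
  rintro rfl
  exact hc h

@[simp] theorem inl_mem_writeSet {i : Fin n} {v : Fin d} :
    (Sum.inl v : Cell n d) ∈ writeSet f i ↔ v ∈ support (f i) := by
  simp [writeSet]

@[simp] theorem inr_mem_writeSet {i j : Fin n} {v : Fin d} :
    (Sum.inr (j, v) : Cell n d) ∈ writeSet f i ↔ j = i ∧ v ∈ support (f i) := by
  simp [writeSet, and_comm, eq_comm]

theorem StepRel.count_le {k : ℕ} {s s' : State n d p} (h : StepRel f γ tape k s s') :
    s.count ≤ s'.count := by
  cases h <;> simp

theorem StepRel.log_eq {k : ℕ} {s s' : State n d p} (h : StepRel f γ tape k s s') {u : ℕ}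
    (hu : u < s.count) : s'.log u = s.log u ∧ s'.begun u = s.begun u := by
  cases h with
  | sample c b copy h =>
    exact ⟨Function.update_of_ne hu.ne _ _, Function.update_of_ne hu.ne _ _⟩
  | _ => exact ⟨rfl, rfl⟩

theorem StepRel.pending_of_count_lt {k : ℕ} {s s' : State n d p} (h : StepRel f γ tape k s s')
    {u : ℕ} (hu : s.count ≤ u) (hu' : u < s'.count) {e : Cell n d}
    (he : e ∈ writeSet f (tape u)) : Pending s' u e := by
  cases h with
  | sample c b copy h =>
    obtain rfl : u = s.count := by
      change u < s.count + 1 at hu'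
      omega
    refine ⟨c, ?_⟩
    simp only [Function.update_self]
    exact ⟨rfl, he⟩
  | _ => exact absurd hu' (by simpa using hu)

variable {R : ℕ → State n d p}

theorem IsExecution.count_mono (hR : IsExecution f γ x0 a0 tape R) :
    Monotone fun k => (R k).count :=
  monotone_nat_of_le_succ fun k => (hR.succ k).count_le

theorem IsExecution.log_eq (hR : IsExecution f γ x0 a0 tape R) {k l u : ℕ} (hkl : k ≤ l)
    (hu : u < (R k).count) : (R l).log u = (R k).log u ∧ (R l).begun u = (R k).begun u := by
  induction l, hkl using Nat.le_induction with
  | base => exact ⟨rfl, rfl⟩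
  | succ l hkl ih =>
    have h1 := (hR.succ l).log_eq (hu.trans_le (hR.count_mono hkl))
    exact ⟨h1.1.trans ih.1, h1.2.trans ih.2⟩

/-- The value returned by the read number `t`. -/
noncomputable def readLog (R : ℕ → State n d p) (t : ℕ) : Mem n d :=
  (R (sInf {k | t < (R k).count})).log t

theorem IsExecution.log_eq_readLog (hR : IsExecution f γ x0 a0 tape R) {k t : ℕ}
    (ht : t < (R k).count) : (R k).log t = readLog R t :=
  have hk : sInf {k | t < (R k).count} ≤ k := Nat.sInf_le ht
  (hR.log_eq hk (Nat.sInf_mem (s := {k | t < (R k).count}) ⟨k, ht⟩)).1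

/-- Bounded overlaps constrain an iteration only once its read is complete. This covers one whose
read is still incomplete: its writes are all pending just after the completion. -/
theorem IsExecution.exists_pending (hR : IsExecution f γ x0 a0 tape R) {k l u : ℕ}
    (hk : (R k).count ≤ u) (hl : u < (R l).count) {e : Cell n d}
    (he : e ∈ writeSet f (tape u)) : ∃ m, k < m ∧ Pending (R m) u e := by
  set S := {k | u < (R k).count} with hS
  have hmem : sInf S ∈ S := Nat.sInf_mem ⟨l, hl⟩
  have hlt : k < sInf S := by
    by_contra h
    have h1 : (R (sInf S)).count ≤ (R k).count := hR.count_mono (not_lt.1 h)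
    exact absurd (hmem : u < _) (not_lt.2 (h1.trans hk))
  refine ⟨sInf S, hlt, ?_⟩
  obtain ⟨m, hm⟩ : ∃ m, sInf S = m + 1 := ⟨sInf S - 1, by omega⟩
  rw [hm] at hmem ⊢
  refine (hR.succ m).pending_of_count_lt ?_ hmem he
  by_contra h
  have : sInf S ≤ m := Nat.sInf_le (not_le.1 h)
  omega

/-- Bookkeeping facts about the state before event `k`. -/
structure Coherent (f : Fin n → Vec d → ℝ) (tape : ℕ → Fin n) (R : ℕ → State n d p) (k : ℕ) :
    Prop where
  reading : ∀ c b copy todo, (R k).core c = Core.reading b copy todo → b < k ∧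
    ∀ e ∉ todo, ∃ k' < k, b < k' ∧ copy e = (R k').mem e
  writing : ∀ c t i copy todo, (R k).core c = Core.writing t i copy todo →
    t < (R k).count ∧ i = tape t ∧ copy = (R k).log t ∧ todo ⊆ writeSet f (tape t)
  unique : ∀ c c' t i i' copy copy' todo todo', (R k).core c = Core.writing t i copy todo →
    (R k).core c' = Core.writing t i' copy' todo' → c = c'
  logged : ∀ t < (R k).count, (R k).begun t < k ∧ ∀ e, ∃ k' < k, (R k).begun t < k' ∧
    (R k').count ≤ t ∧ (R k).log t e = (R k').mem e

theorem update_core_cases {core : Fin p → Core n d} {c c' : Fin p} {new x : Core n d}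
    (h : Function.update core c new c' = x) : (c' = c ∧ new = x) ∨ (c' ≠ c ∧ core c' = x) := by
  rcases eq_or_ne c' c with rfl | hne
  · exact Or.inl ⟨rfl, by rwa [Function.update_self] at h⟩
  · exact Or.inr ⟨hne, by rwa [Function.update_of_ne hne] at h⟩

/-- When a read is logged nothing is left to copy, so the clause on `reading` accounts for every
cell. Its label `count` exceeds all labels in use, which preserves uniqueness. -/
theorem IsExecution.coherent (hR : IsExecution f γ x0 a0 tape R) (k : ℕ) :
    Coherent f tape R k := by
  induction k with
  | zero =>
    refine ⟨?_, ?_, ?_, ?_⟩ <;> intros <;> simp_all [hR.zero, initialState]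
  | succ k ih =>
    have hlogged : ∀ t < (R k).count, (R (k + 1)).begun t < k + 1 ∧
        ∀ e, ∃ k' < k + 1, (R (k + 1)).begun t < k' ∧ (R k').count ≤ t ∧
          (R (k + 1)).log t e = (R k').mem e := by
      intro t ht
      obtain ⟨h1, h2⟩ := ih.logged t ht
      obtain ⟨h3, h4⟩ := (hR.succ k).log_eq ht
      rw [h3, h4]
      refine ⟨by omega, fun e => ?_⟩
      obtain ⟨k', h5, h6⟩ := h2 e
      exact ⟨k', by omega, h6⟩
    have hcount : ∀ k' < k + 1, (R k').count ≤ (R k).count := fun k' hk' =>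
      hR.count_mono (by omega)
    have hreading : ∀ c b copy todo, (R k).core c = Core.reading b copy todo → b < k + 1 ∧
        ∀ e ∉ todo, ∃ k' < k + 1, b < k' ∧ copy e = (R k').mem e := by
      intro c b copy todo h
      obtain ⟨h1, h2⟩ := ih.reading c b copy todo h
      refine ⟨by omega, fun e he => ?_⟩
      obtain ⟨k', h3, h4⟩ := h2 e he
      exact ⟨k', by omega, h4⟩
    have hstep := hR.succ k
    generalize hs' : R (k + 1) = s' at hstep hlogged
    cases hstep with
    | skip =>
      refine ⟨?_, ?_, ?_, ?_⟩
      · rw [hs']; exact hreading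
      · rw [hs']; exact ih.writing
      · rw [hs']; exact ih.unique
      · rw [hs']; exact hlogged
    | start c hc =>
      refine ⟨?_, ?_, ?_, ?_⟩
      · rw [hs']
        intro c' b copy todo h
        replace h := update_core_cases (core := (R k).core) (c := c) h
        rcases h with ⟨rfl, h⟩ | ⟨_, h⟩
        · cases h
          exact ⟨by omega, fun e he => absurd (mem_univ e) he⟩
        · exact hreading c' b copy todo h
      · rw [hs']
        intro c' t i copy todo h
        replace h := update_core_cases (core := (R k).core) (c := c) h
        rcases h with ⟨rfl, h⟩ | ⟨_, h⟩
        · cases h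
        · exact ih.writing c' t i copy todo h
      · rw [hs']
        intro c1 c2 t i i' copy copy' todo todo' h1 h2
        replace h1 := update_core_cases (core := (R k).core) (c := c) h1
        rcases h1 with ⟨rfl, h1⟩ | ⟨_, h1⟩
        · cases h1
        replace h2 := update_core_cases (core := (R k).core) (c := c) h2
        rcases h2 with ⟨rfl, h2⟩ | ⟨_, h2⟩
        · cases h2
        exact ih.unique c1 c2 t i i' copy copy' todo todo' h1 h2
      · rw [hs']; exact hlogged
    | read c b copy todo e hc he =>
      refine ⟨?_, ?_, ?_, ?_⟩
      · rw [hs']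
        intro c' b' copy' todo' h
        replace h := update_core_cases (core := (R k).core) (c := c) h
        rcases h with ⟨rfl, h⟩ | ⟨_, h⟩
        · cases h
          obtain ⟨h1, h2⟩ := hreading _ _ _ _ hc
          refine ⟨h1, fun e' he' => ?_⟩
          rcases eq_or_ne e' e with rfl | hne
          · exact ⟨k, by omega, (ih.reading _ _ _ _ hc).1, Function.update_self _ _ _⟩
          · rw [Function.update_of_ne hne]
            exact h2 e' fun hmem => he' (mem_erase.2 ⟨hne, hmem⟩)
        · exact hreading c' b' copy' todo' h
      · rw [hs']
        intro c' t i copy todo h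
        replace h := update_core_cases (core := (R k).core) (c := c) h
        rcases h with ⟨rfl, h⟩ | ⟨_, h⟩
        · cases h
        · exact ih.writing c' t i copy todo h
      · rw [hs']
        intro c1 c2 t i i' copy copy' todo todo' h1 h2
        replace h1 := update_core_cases (core := (R k).core) (c := c) h1
        rcases h1 with ⟨rfl, h1⟩ | ⟨_, h1⟩
        · cases h1
        replace h2 := update_core_cases (core := (R k).core) (c := c) h2
        rcases h2 with ⟨rfl, h2⟩ | ⟨_, h2⟩
        · cases h2
        exact ih.unique c1 c2 t i i' copy copy' todo todo' h1 h2
      · rw [hs']; exact hlogged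
    | sample c b copy hc =>
      refine ⟨?_, ?_, ?_, ?_⟩
      · rw [hs']
        intro c' b' copy' todo' h
        replace h := update_core_cases (core := (R k).core) (c := c) h
        rcases h with ⟨rfl, h⟩ | ⟨_, h⟩
        · cases h
        · exact hreading c' b' copy' todo' h
      · rw [hs']
        intro c' t i copy' todo' h
        replace h := update_core_cases (core := (R k).core) (c := c) h
        rcases h with ⟨rfl, h⟩ | ⟨_, h⟩
        · cases h
          exact ⟨Nat.lt_succ_self _, rfl, by simp, Subset.rfl⟩
        · obtain ⟨h1, h2, h3, h4⟩ := ih.writing c' t i copy' todo' h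
          refine ⟨Nat.lt_succ_of_lt h1, h2, ?_, h4⟩
          rw [h3]
          exact (Function.update_of_ne h1.ne _ _).symm
      · rw [hs']
        intro c1 c2 t i i' copy1 copy2 todo1 todo2 h1 h2
        replace h1 := update_core_cases (core := (R k).core) (c := c) h1
        replace h2 := update_core_cases (core := (R k).core) (c := c) h2
        rcases h1 with ⟨rfl, h1⟩ | ⟨_, h1⟩ <;>
          rcases h2 with ⟨rfl, h2⟩ | ⟨_, h2⟩
        · rfl
        · cases h1
          exact absurd (ih.writing _ _ _ _ _ h2).1 (lt_irrefl _)
        · cases h2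
          exact absurd (ih.writing _ _ _ _ _ h1).1 (lt_irrefl _)
        · exact ih.unique c1 c2 t i i' copy1 copy2 todo1 todo2 h1 h2
      · rw [hs']
        intro t ht
        rcases Nat.lt_succ_iff_lt_or_eq.1 (ht : t < (R k).count + 1) with h | rfl
        · exact hlogged t h
        · obtain ⟨h1, h2⟩ := hreading _ _ _ _ hc
          simp only [Function.update_self]
          refine ⟨h1, fun e => ?_⟩
          obtain ⟨k', h3, h4, h5⟩ := h2 e (notMem_empty e)
          exact ⟨k', h3, h4, hcount k' h3, h5⟩
    | write c t0 i0 copy0 todo0 e0 hc he =>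
      refine ⟨?_, ?_, ?_, ?_⟩
      · rw [hs']
        intro c' b' copy' todo' h
        replace h := update_core_cases (core := (R k).core) (c := c) h
        rcases h with ⟨rfl, h⟩ | ⟨_, h⟩
        · cases h
        · exact hreading c' b' copy' todo' h
      · rw [hs']
        intro c' t i copy' todo' h
        replace h := update_core_cases (core := (R k).core) (c := c) h
        rcases h with ⟨rfl, h⟩ | ⟨_, h⟩
        · cases h
          obtain ⟨h1, h2, h3, h4⟩ := ih.writing _ _ _ _ _ hc
          exact ⟨h1, h2, h3, (erase_subset _ _).trans h4⟩
        · exact ih.writing c' t i copy' todo' h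
      · rw [hs']
        intro c1 c2 t i i' copy1 copy2 todo1 todo2 h1 h2
        replace h1 := update_core_cases (core := (R k).core) (c := c) h1
        replace h2 := update_core_cases (core := (R k).core) (c := c) h2
        rcases h1 with ⟨rfl, h1⟩ | ⟨_, h1⟩ <;>
          rcases h2 with ⟨rfl, h2⟩ | ⟨_, h2⟩
        · rfl
        · cases h1
          exact ih.unique _ _ _ _ _ _ _ _ _ hc h2
        · cases h2
          exact ih.unique _ _ _ _ _ _ _ _ _ h1 hc
        · exact ih.unique c1 c2 t i i' copy1 copy2 todo1 todo2 h1 h2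
      · rw [hs']; exact hlogged
    | finish c t0 i0 copy0 hc =>
      refine ⟨?_, ?_, ?_, ?_⟩
      · rw [hs']
        intro c' b copy todo h
        replace h := update_core_cases (core := (R k).core) (c := c) h
        rcases h with ⟨rfl, h⟩ | ⟨_, h⟩
        · cases h
        · exact hreading c' b copy todo h
      · rw [hs']
        intro c' t i copy todo h
        replace h := update_core_cases (core := (R k).core) (c := c) h
        rcases h with ⟨rfl, h⟩ | ⟨_, h⟩
        · cases h
        · exact ih.writing c' t i copy todo h
      · rw [hs']
        intro c1 c2 t i i' copy copy' todo todo' h1 h2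
        replace h1 := update_core_cases (core := (R k).core) (c := c) h1
        rcases h1 with ⟨rfl, h1⟩ | ⟨_, h1⟩
        · cases h1
        replace h2 := update_core_cases (core := (R k).core) (c := c) h2
        rcases h2 with ⟨rfl, h2⟩ | ⟨_, h2⟩
        · cases h2
        exact ih.unique c1 c2 t i i' copy copy' todo todo' h1 h2
      · rw [hs']; exact hlogged

end Execution

/-! ### Contents of the shared memory, and the structure of the reads. -/

section Memory
variable {n d p : ℕ} {f : Fin n → Vec d → ℝ} {γ : ℝ} {x0 : Vec d} {a0 : Fin n → Vec d}
  {tape : ℕ → Fin n} {τ : ℕ} {R : ℕ → State n d p}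

/-- An operation that neither writes to memory nor completes a read changes no pending write. -/
theorem pending_update_iff {s s' : State n d p} {c : Fin p} {new : Core n d}
    (hs' : s'.core = Function.update s.core c new) {u : ℕ} {e : Cell n d}
    (hc : ¬(s.core c).Owes u e) : Pending s' u e ↔ new.Owes u e ∨ Pending s u e := by
  rw [Pending, hs']
  exact exists_owes_update_iff_of_not _ _ _ _ _ hc

/-- One core at most works for iteration `t`, so writing a cell removes this pending write
completely. -/
theorem Coherent.pending_write_iff {k : ℕ} (h : Coherent f tape R k) {s' : State n d p}
    {c : Fin p} {t : ℕ} {i : Fin n} {copy : Mem n d} {todo : Finset (Cell n d)} {e0 : Cell n d}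
    (hc : (R k).core c = Core.writing t i copy todo)
    (hs' : s'.core = Function.update (R k).core c (Core.writing t i copy (todo.erase e0)))
    (u : ℕ) (e : Cell n d) :
    Pending s' u e ↔ Pending (R k) u e ∧ ¬(u = t ∧ e = e0) := by
  rw [Pending, hs', exists_owes_update_iff]
  have howes : ∀ c', ((R k).core c').Owes t e → c' = c := by
    intro c' hc'
    cases hcore : (R k).core c' with
    | idle => rw [hcore] at hc'; exact hc'.elim
    | reading b copy todo => rw [hcore] at hc'; exact hc'.elim
    | writing t' i' copy' todo' =>
      rw [hcore] at hc'
      obtain ⟨rfl, -⟩ := hc'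
      exact h.unique _ _ _ _ _ _ _ _ _ hcore hc
  constructor
  · rintro (⟨rfl, he⟩ | ⟨c', hne, hc'⟩)
    · rw [mem_erase] at he
      refine ⟨⟨c, ?_⟩, fun h' => he.1 h'.2⟩
      rw [hc]
      exact ⟨rfl, he.2⟩
    · refine ⟨⟨c', hc'⟩, ?_⟩
      rintro ⟨rfl, rfl⟩
      exact hne (howes c' hc')
  · rintro ⟨⟨c', hc'⟩, hne⟩
    rcases eq_or_ne c' c with rfl | hcc
    · left
      rw [hc] at hc'
      obtain ⟨rfl, he⟩ := hc'
      exact ⟨rfl, mem_erase.2 ⟨fun h' => hne ⟨rfl, h'⟩, he⟩⟩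
    · exact Or.inr ⟨c', hcc, hc'⟩

open Classical in
/-- The shared `x` contains the written updates, and only them. -/
def MemXSpec (f : Fin n → Vec d → ℝ) (γ : ℝ) (x0 : Vec d) (tape : ℕ → Fin n)
    (s : State n d p) : Prop :=
  ∀ v, s.mem (Sum.inl v) = x0 v - γ * ∑ u ∈ (range s.count).filter
    (fun u => ¬Pending s u (Sum.inl v)),
      sparseDirection f (s.log u).x (s.log u).a (tape u) v

/-- Any cell of the shared `α_j` holds its initial value or has been written by an iteration `u`
such that no iteration of index larger than `u + τ` has written it. -/
def MemASpec (f : Fin n → Vec d → ℝ) (a0 : Fin n → Vec d) (τ : ℕ) (tape : ℕ → Fin n)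
    (s : State n d p) : Prop :=
  ∀ j v, (s.mem (Sum.inr (j, v)) = a0 j v ∧
      ∀ u < s.count, v ∈ support (f j) → tape u = j → Pending s u (Sum.inr (j, v))) ∨
    ∃ u < s.count, tape u = j ∧ v ∈ support (f j) ∧
      s.mem (Sum.inr (j, v)) = gradient (f j) (s.log u).x v ∧
      ∀ r < s.count, u + τ < r → tape r = j → Pending s r (Sum.inr (j, v))

theorem MemXSpec.congr {s s' : State n d p} (h : MemXSpec f γ x0 tape s)
    (hm : s'.mem = s.mem) (hc : s'.count = s.count) (hl : s'.log = s.log)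
    (hp : ∀ u e, Pending s' u e ↔ Pending s u e) : MemXSpec f γ x0 tape s' := by
  classical
  intro v
  rw [hm, hc, hl, h v, filter_congr fun u _ => not_congr (hp u (Sum.inl v))]

theorem MemASpec.congr {s s' : State n d p} (h : MemASpec f a0 τ tape s)
    (hm : s'.mem = s.mem) (hc : s'.count = s.count) (hl : s'.log = s.log)
    (hp : ∀ u e, Pending s' u e ↔ Pending s u e) : MemASpec f a0 τ tape s' := by
  intro j v
  simp only [hm, hc, hl, hp]
  exact h j v

/-- Each step is a read-only step, or completes a read, or writes one cell. -/
theorem IsExecution.step_cases (hR : IsExecution f γ x0 a0 tape R) (k : ℕ) :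
    ((R (k + 1)).mem = (R k).mem ∧ (R (k + 1)).count = (R k).count ∧
      (R (k + 1)).log = (R k).log ∧ ∀ u e, Pending (R (k + 1)) u e ↔ Pending (R k) u e) ∨
    ((R (k + 1)).mem = (R k).mem ∧ (R (k + 1)).count = (R k).count + 1 ∧
      ∀ u e, Pending (R (k + 1)) u e ↔
        (u = (R k).count ∧ e ∈ writeSet f (tape u)) ∨ Pending (R k) u e) ∨
    ∃ t e0, t < (R k).count ∧ e0 ∈ writeSet f (tape t) ∧ Pending (R k) t e0 ∧
      (R (k + 1)).mem = Function.update (R k).mem e0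
        (newValue f γ (tape t) ((R k).log t) (R k).mem e0) ∧
      (R (k + 1)).count = (R k).count ∧ (R (k + 1)).log = (R k).log ∧
      ∀ u e, Pending (R (k + 1)) u e ↔ Pending (R k) u e ∧ ¬(u = t ∧ e = e0) := by
  have hcoh := hR.coherent k
  have hstep := hR.succ k
  generalize R (k + 1) = s' at hstep
  cases hstep with
  | skip => exact Or.inl ⟨rfl, rfl, rfl, fun _ _ => Iff.rfl⟩
  | start c hc =>
    refine Or.inl ⟨rfl, rfl, rfl, fun u e => ?_⟩
    rw [pending_update_iff (s := R k) rfl (by rw [hc]; exact id)]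
    exact or_iff_right id
  | read c b copy todo e hc he =>
    refine Or.inl ⟨rfl, rfl, rfl, fun u e => ?_⟩
    rw [pending_update_iff (s := R k) rfl (by rw [hc]; exact id)]
    exact or_iff_right id
  | sample c b copy hc =>
    refine Or.inr (Or.inl ⟨rfl, rfl, fun u e => ?_⟩)
    rw [pending_update_iff (s := R k) rfl (by rw [hc]; exact id)]
    refine or_congr ⟨?_, ?_⟩ Iff.rfl
    · rintro ⟨rfl, h⟩
      exact ⟨rfl, h⟩
    · rintro ⟨rfl, h⟩
      exact ⟨rfl, h⟩
  | write c t i copy todo e0 hc he =>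
    obtain ⟨h1, rfl, rfl, h4⟩ := hcoh.writing _ _ _ _ _ hc
    refine Or.inr (Or.inr ⟨t, e0, h1, h4 he, ⟨c, ?_⟩, rfl, rfl, rfl, fun u e => ?_⟩)
    · rw [hc]
      exact ⟨rfl, he⟩
    · exact hcoh.pending_write_iff hc rfl u e
  | finish c t i copy hc =>
    refine Or.inl ⟨rfl, rfl, rfl, fun u e => ?_⟩
    rw [pending_update_iff (s := R k) rfl (by rw [hc]; exact fun h => notMem_empty _ h.2)]
    exact or_iff_right id

/-- Atomic additions commute, so only the set of written updates matters, not their order. -/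
theorem IsExecution.memXSpec (hR : IsExecution f γ x0 a0 tape R) (k : ℕ) :
    MemXSpec f γ x0 tape (R k) := by
  classical
  induction k with
  | zero => intro v; simp [hR.zero, initialState]
  | succ k ih =>
    have hcoh := hR.coherent k
    have hlog : ∀ u < (R k).count, (R (k + 1)).log u = (R k).log u := fun u hu =>
      ((hR.succ k).log_eq hu).1
    rcases hR.step_cases k with ⟨hm, hc, hl, hp⟩ | ⟨hm, hc, hp⟩ |
      ⟨t, e0, ht, he0, hpend, hm, hc, hl, hp⟩
    · exact ih.congr hm hc hl hp
    · intro v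
      rw [hm, hc, ih v, range_add_one, filter_insert]
      have hold : (range (R k).count).filter (fun u => ¬Pending (R (k + 1)) u (Sum.inl v)) =
          (range (R k).count).filter (fun u => ¬Pending (R k) u (Sum.inl v)) := by
        refine filter_congr fun u hu => ?_
        rw [hp, or_iff_right]
        rintro ⟨rfl, -⟩
        simp at hu
      have hsum : ∑ u ∈ (range (R k).count).filter (fun u => ¬Pending (R k) u (Sum.inl v)),
          sparseDirection f ((R (k + 1)).log u).x ((R (k + 1)).log u).a (tape u) v =
          ∑ u ∈ (range (R k).count).filter (fun u => ¬Pending (R k) u (Sum.inl v)),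
          sparseDirection f ((R k).log u).x ((R k).log u).a (tape u) v :=
        sum_congr rfl fun u hu => by rw [hlog u (mem_range.1 (mem_filter.1 hu).1)]
      rw [hold]
      split_ifs with h
      · rw [hsum]
      · rw [sum_insert (by simp), hsum]
        -- A newly labelled iteration that owes nothing at `v` enters the sum at once, but its
        -- update is zero there.
        have hv : v ∉ support (f (tape (R k).count)) := by
          intro hv
          exact absurd ((hp _ _).2 (Or.inl ⟨rfl, inl_mem_writeSet.2 hv⟩)) h
        rw [sparseDirection_apply_eq_zero hv, zero_add]
    · intro v
      rw [hm, hc, hl]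
      by_cases hv : e0 = Sum.inl v
      · subst hv
        rw [Function.update_self]
        have hset : (range (R k).count).filter (fun u => ¬Pending (R (k + 1)) u (Sum.inl v)) =
            insert t ((range (R k).count).filter (fun u => ¬Pending (R k) u (Sum.inl v))) := by
          ext u
          simp only [mem_filter, mem_insert, mem_range, hp, and_true, not_and_or, not_not]
          constructor
          · rintro ⟨h1, h2 | h2⟩
            · exact Or.inr ⟨h1, h2⟩
            · exact Or.inl h2
          · rintro (rfl | ⟨h1, h2⟩)
            · exact ⟨ht, Or.inr rfl⟩
            · exact ⟨h1, Or.inl h2⟩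
        rw [hset, sum_insert (by simp [hpend])]
        have hs : sparseDirection f ((R k).log t).x ((R k).log t).a (tape t) v =
            direction f ((R k).log t).x ((R k).log t).a (tape t) v := by
          simp [sparseDirection, inl_mem_writeSet.1 he0]
        rw [hs, newValue, ih v]
        ring
      · rw [Function.update_of_ne (Ne.symm hv), ih v]
        have : ∀ u, Pending (R (k + 1)) u (Sum.inl v) ↔ Pending (R k) u (Sum.inl v) := by
          intro u
          rw [hp, and_iff_left]
          rintro ⟨-, h⟩
          exact hv h.symm
        simp only [this]

theorem IsExecution.memASpec (hR : IsExecution f γ x0 a0 tape R) (hτ : BoundedOverlaps τ R)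
    (k : ℕ) : MemASpec f a0 τ tape (R k) := by
  induction k with
  | zero => intro j v; left; simp [hR.zero, initialState]
  | succ k ih =>
    have hcoh := hR.coherent k
    have hlog : ∀ u < (R k).count, (R (k + 1)).log u = (R k).log u := fun u hu =>
      ((hR.succ k).log_eq hu).1
    rcases hR.step_cases k with ⟨hm, hc, hl, hp⟩ | ⟨hm, hc, hp⟩ |
      ⟨t, e0, ht, he0, hpend, hm, hc, hl, hp⟩
    · exact ih.congr hm hc hl hp
    · intro j v
      rw [hm, hc]
      have hnew : ∀ u < (R k).count + 1, v ∈ support (f j) → tape u = j →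
          (u < (R k).count → Pending (R k) u (Sum.inr (j, v))) →
          Pending (R (k + 1)) u (Sum.inr (j, v)) := by
        intro u hu hv hj h
        rw [hp]
        rcases Nat.lt_succ_iff_lt_or_eq.1 hu with h1 | h1
        · exact Or.inr (h h1)
        · exact Or.inl ⟨h1, inr_mem_writeSet.2 ⟨hj.symm, hj ▸ hv⟩⟩
      rcases ih j v with ⟨h1, h2⟩ | ⟨u, hu, h1, h2, h3, h4⟩
      · exact Or.inl ⟨h1, fun u hu hv hj => hnew u hu hv hj fun h => h2 u h hv hj⟩
      · exact Or.inr ⟨u, by omega, h1, h2, by rw [hlog u hu]; exact h3,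
          fun r hr hur hj => hnew r hr h2 hj fun h => h4 r h hur hj⟩
    · intro j v
      rw [hm, hc, hl]
      by_cases hv : e0 = Sum.inr (j, v)
      · subst hv
        obtain ⟨hj, hv⟩ := inr_mem_writeSet.1 he0
        refine Or.inr ⟨t, ht, hj.symm, hj ▸ hv, ?_, ?_⟩
        · rw [Function.update_self, newValue, hj]
        · intro r hr htr _
          -- Iteration `t` is unfinished at event `k`, so by bounded overlaps no iteration past `t +
          -- τ` began before `k`; yet every completed read did. Hence no such `r` exists.
          have h1 := hτ t r k k (by omega) hr hpend.unfinished
          exact absurd (hcoh.logged r hr).1 (not_lt.2 h1)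
      · rw [Function.update_of_ne (Ne.symm hv)]
        have : ∀ u, Pending (R (k + 1)) u (Sum.inr (j, v)) ↔ Pending (R k) u (Sum.inr (j, v)) := by
          intro u
          rw [hp, and_iff_left]
          rintro ⟨-, h⟩
          exact hv h.symm
        simp only [this]
        exact ih j v

/-- An iteration older than the overlap bound has written everything when a read takes place. -/
theorem IsExecution.settled (hR : IsExecution f γ x0 a0 tape R) (hτ : BoundedOverlaps τ R)
    {l t r k : ℕ} (ht : t < (R l).count) (hk : (R l).begun t < k) (hr : r + τ < t)
    {e : Cell n d} (he : e ∈ writeSet f (tape r)) :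
    r < (R k).count ∧ ¬Pending (R k) r e := by
  constructor
  · by_contra h
    obtain ⟨m, hkm, hm⟩ := hR.exists_pending (not_lt.1 h) (l := l) (by omega) he
    have := hτ r t m l (by omega) ht hm.unfinished
    omega
  · intro h
    have := hτ r t k l (by omega) ht h.unfinished
    omega

/-- Every cell of the read is a copy of the memory at some event after the iteration began, when all
iterations older than the overlap bound are settled. The event depends on the cell, hence the set
`U` on the coordinate. -/
theorem IsExecution.structuredAt (hR : IsExecution f γ x0 a0 tape R) (hτ : BoundedOverlaps τ R)
    {t l : ℕ} (ht : t < (R l).count) :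
    StructuredAt f γ x0 a0 τ tape (readLog R) t := by
  classical
  have hlogged := ((hR.coherent l).logged t ht).2
  rw [hR.log_eq_readLog ht] at hlogged
  constructor
  · intro v
    obtain ⟨k, -, hbk, hcount, hval⟩ := hlogged (Sum.inl v)
    refine ⟨(range (R k).count).filter (fun u => ¬Pending (R k) u (Sum.inl v)),
      (filter_subset _ _).trans (range_mono hcount), fun u hu hv => ?_, ?_⟩
    · have := hR.settled hτ ht hbk hu (inl_mem_writeSet.2 hv)
      exact mem_filter.2 ⟨mem_range.2 this.1, this.2⟩
    · change readLog R t (Sum.inl v) = _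
      rw [hval, hR.memXSpec k v]
      congr 2
      refine sum_congr rfl fun u hu => ?_
      rw [hR.log_eq_readLog (mem_range.1 (mem_filter.1 hu).1)]
  · intro j v
    obtain ⟨k, -, hbk, hcount, hval⟩ := hlogged (Sum.inr (j, v))
    change (readLog R t (Sum.inr (j, v)) = _ ∧ _) ∨
      ∃ u < t, _ ∧ _ ∧ readLog R t (Sum.inr (j, v)) = _ ∧ _
    rw [hval]
    rcases hR.memASpec hτ k j v with ⟨h1, h2⟩ | ⟨u, hu, h1, h2, h3, h4⟩
    · refine Or.inl ⟨h1, fun hv r hr hj => ?_⟩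
      have := hR.settled hτ ht hbk hr (inr_mem_writeSet.2 ⟨hj.symm, hj ▸ hv⟩)
      exact this.2 (h2 r this.1 hv hj)
    · refine Or.inr ⟨u, by omega, h2, h1, ?_, fun r hur hr hj => ?_⟩
      · rw [h3, hR.log_eq_readLog hu]
      · have := hR.settled hτ ht hbk hr (inr_mem_writeSet.2 ⟨hj.symm, hj ▸ h2⟩)
        exact this.2 (h4 r this.1 hur hj)

end Memory

/-! ### Reads depend only on earlier samples. -/

section Causality
variable {n d p : ℕ} {f : Fin n → Vec d → ℝ} {γ : ℝ} {x0 : Vec d} {a0 : Fin n → Vec d}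

/-- A step depends on the tape only through the sample it draws, and even then the log does not. -/
theorem step_causal {tape tape' : ℕ → Fin n} {t k : ℕ} (h : ∀ u < t, tape u = tape' u)
    (c : Fin p) (e : Cell n d) (s : State n d p) (hs : s.count ≤ t) :
    ((step f γ tape k c e s).count ≤ t ∧ step f γ tape k c e s = step f γ tape' k c e s) ∨
    (t < (step f γ tape k c e s).count ∧ t < (step f γ tape' k c e s).count ∧
      (step f γ tape k c e s).log t = (step f γ tape' k c e s).log t) := by
  unfold step
  split
  · exact Or.inl ⟨hs, rfl⟩
  · next b copy todo hc =>
    split_ifs with h1 h2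
    · exact Or.inl ⟨hs, rfl⟩
    · rcases hs.eq_or_lt with h3 | h3
      · exact Or.inr ⟨by simp [h3], by simp [h3], rfl⟩
      · exact Or.inl ⟨h3, by rw [h _ h3]⟩
    · exact Or.inl ⟨hs, rfl⟩
  · split_ifs with h1 h2
    · exact Or.inl ⟨hs, rfl⟩
    · exact Or.inl ⟨hs, rfl⟩
    · exact Or.inl ⟨hs, rfl⟩

/-- Until read `t` completes, the scheduler sees only samples before `t` and both runs coincide. The
completing event logs the copy made before sample `t` is drawn, and logged values never change. -/
theorem run_causal (sched : Scheduler n d p) {tape tape' : ℕ → Fin n} {t : ℕ}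
    (h : ∀ u < t, tape u = tape' u) (k : ℕ) :
    ((run f γ x0 a0 sched tape k).count ≤ t ∧
      run f γ x0 a0 sched tape k = run f γ x0 a0 sched tape' k) ∨
    (t < (run f γ x0 a0 sched tape k).count ∧ t < (run f γ x0 a0 sched tape' k).count ∧
      (run f γ x0 a0 sched tape k).log t = (run f γ x0 a0 sched tape' k).log t) := by
  induction k with
  | zero => exact Or.inl ⟨Nat.zero_le _, rfl⟩
  | succ k ih =>
    rcases ih with ⟨h1, h2⟩ | ⟨h1, h2, h3⟩
    · have hlist : (List.range (run f γ x0 a0 sched tape k).count).map tape =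
          (List.range (run f γ x0 a0 sched tape k).count).map tape' :=
        List.map_congr_left fun u hu => h u ((List.mem_range.1 hu).trans_le h1)
      have h3 : run f γ x0 a0 sched tape' (k + 1) = step f γ tape' k
          (sched k ((List.range (run f γ x0 a0 sched tape k).count).map tape)).1
          (sched k ((List.range (run f γ x0 a0 sched tape k).count).map tape)).2
          (run f γ x0 a0 sched tape k) := by
        rw [run, ← h2, hlist]
      rw [h3]
      exact step_causal h _ _ _ h1
    · have hR := isExecution_run (f := f) (γ := γ) (x0 := x0) (a0 := a0) (tape := tape) sched
      have hR' := isExecution_run (f := f) (γ := γ) (x0 := x0) (a0 := a0) (tape := tape') sched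
      refine Or.inr ⟨h1.trans_le (hR.count_mono k.le_succ), h2.trans_le (hR'.count_mono k.le_succ),
        ?_⟩
      rw [(hR.log_eq k.le_succ h1).1, (hR'.log_eq k.le_succ h2).1, h3]

/-- The read number `t` depends only on the first `t` samples. -/
theorem readLog_run_causal (sched : Scheduler n d p) {tape tape' : ℕ → Fin n} {t : ℕ}
    (h : ∀ u < t, tape u = tape' u) :
    readLog (run f γ x0 a0 sched tape) t = readLog (run f γ x0 a0 sched tape') t := by
  have hset : {k | t < (run f γ x0 a0 sched tape k).count} =
      {k | t < (run f γ x0 a0 sched tape' k).count} := by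
    ext k
    rw [Set.mem_ofPred_eq, Set.mem_ofPred_eq]
    rcases run_causal (f := f) (γ := γ) (x0 := x0) (a0 := a0) sched h k with
      ⟨h1, h2⟩ | ⟨h1, h2, -⟩
    · rw [h2]
    · exact iff_of_true h1 h2
  rw [readLog, readLog, ← hset]
  rcases run_causal (f := f) (γ := γ) (x0 := x0) (a0 := a0) sched h
    (sInf {k | t < (run f γ x0 a0 sched tape k).count}) with ⟨h1, h2⟩ | ⟨h1, h2, h3⟩
  · rw [h2]
  · exact h3

end Causality

/-! ### Measurability through countable ranges. -/

section DiscreteRandomness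
variable {Z β β' : Type*} [MeasurableSpace Z]

/-- A function with countably many values, each taken on a measurable set. -/
def DiscreteMeasurable (F : Z → β) : Prop :=
  (Set.range F).Countable ∧ ∀ b, MeasurableSet (F ⁻¹' {b})

/-- A countable range makes any σ-algebra on the codomain unnecessary. Machine states have this
property for a fixed tape, since each scheduling decision is one of finitely many. -/
theorem DiscreteMeasurable.preimage {F : Z → β} (hF : DiscreteMeasurable F) (S : Set β) :
    MeasurableSet (F ⁻¹' S) := by
  have : F ⁻¹' S = ⋃ b ∈ S ∩ Set.range F, F ⁻¹' {b} := by
    ext z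
    simp
  rw [this]
  exact MeasurableSet.biUnion (hF.1.mono Set.inter_subset_right) fun b _ => hF.2 b

theorem discreteMeasurable_const (b : β) : DiscreteMeasurable (fun _ : Z => b) :=
  ⟨(Set.countable_singleton b).mono (Set.range_subset_iff.2 fun _ => Set.mem_singleton b),
    fun c => MeasurableSet.const (b = c)⟩

/-- A discretely measurable choice among discretely measurable functions. -/
theorem DiscreteMeasurable.bind {F : Z → β} {G : β → Z → β'} (hF : DiscreteMeasurable F)
    (hG : ∀ b, DiscreteMeasurable (G b)) : DiscreteMeasurable (fun z => G (F z) z) := by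
  constructor
  · refine (hF.1.biUnion fun b _ => (hG b).1).mono ?_
    rintro _ ⟨z, rfl⟩
    exact Set.mem_biUnion ⟨z, rfl⟩ ⟨z, rfl⟩
  · intro c
    have : (fun z => G (F z) z) ⁻¹' {c} = ⋃ b ∈ Set.range F, F ⁻¹' {b} ∩ G b ⁻¹' {c} := by
      ext z
      simp only [Set.mem_preimage, Set.mem_singleton_iff, Set.mem_range, Set.mem_iUnion,
        Set.mem_inter_iff, exists_prop]
      exact ⟨fun h => ⟨F z, ⟨z, rfl⟩, rfl, h⟩, fun ⟨b, _, hb, h⟩ => by rw [hb]; exact h⟩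
    rw [this]
    exact MeasurableSet.biUnion hF.1 fun b _ => (hF.2 b).inter ((hG b).2 c)

theorem DiscreteMeasurable.map {F : Z → β} (hF : DiscreteMeasurable F) (g : β → β') :
    DiscreteMeasurable (fun z => g (F z)) :=
  hF.bind fun b => discreteMeasurable_const (g b)

theorem DiscreteMeasurable.measurable {F : Z → β} (hF : DiscreteMeasurable F)
    [MeasurableSpace β] : Measurable F :=
  fun S _ => hF.preimage S

theorem discreteMeasurable_sInf {S : Z → Set ℕ} (hS : ∀ k, MeasurableSet {z | k ∈ S z}) :
    DiscreteMeasurable (fun z => sInf (S z)) := by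
  refine ⟨Set.to_countable _, fun m => ?_⟩
  -- The second piece accounts for `sInf ∅ = 0`.
  have : (fun z => sInf (S z)) ⁻¹' {m} =
      ({z | m ∈ S z} ∩ ⋂ k ∈ Set.Iio m, {z | k ∈ S z}ᶜ) ∪
        ((if m = 0 then Set.univ else ∅) ∩ ⋂ k, {z | k ∈ S z}ᶜ) := by
    ext z
    simp only [Set.mem_preimage, Set.mem_singleton_iff, Set.mem_union, Set.mem_inter_iff,
      Set.mem_iInter, Set.mem_compl_iff, Set.mem_ofPred_eq, Set.mem_Iio]
    constructor
    · rintro rfl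
      rcases (S z).eq_empty_or_nonempty with h | h
      · right
        simp [h]
      · exact Or.inl ⟨Nat.sInf_mem h, fun k hk => Nat.notMem_of_lt_sInf hk⟩
    · rintro (⟨h1, h2⟩ | ⟨h1, h2⟩)
      · refine le_antisymm (Nat.sInf_le h1) ?_
        by_contra h
        exact h2 _ (not_le.1 h) (Nat.sInf_mem ⟨m, h1⟩)
      · have h3 : S z = ∅ := Set.eq_empty_of_forall_notMem h2
        by_cases hm : m = 0
        · simp [h3, hm]
        · simp [hm] at h1
  rw [this]
  refine ((hS m).inter (MeasurableSet.biInter (Set.to_countable _) fun k _ =>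
    (hS k).compl)).union (MeasurableSet.inter ?_ (MeasurableSet.iInter fun k => (hS k).compl))
  split_ifs
  exacts [MeasurableSet.univ, MeasurableSet.empty]

variable {n d p : ℕ} {f : Fin n → Vec d → ℝ} {γ : ℝ} {x0 : Vec d} {a0 : Fin n → Vec d} {τ : ℕ}
  {sched : Z → Scheduler n d p}

theorem discreteMeasurable_sched (hsched : ∀ k h e, MeasurableSet {z | sched z k h = e}) (k : ℕ)
    (h : List (Fin n)) : DiscreteMeasurable (fun z => sched z k h) :=
  ⟨Set.to_countable _, fun e => hsched k h e⟩

theorem discreteMeasurable_run (hsched : ∀ k h e, MeasurableSet {z | sched z k h = e})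
    (tape : ℕ → Fin n) (k : ℕ) :
    DiscreteMeasurable (fun z => run f γ x0 a0 (sched z) tape k) := by
  induction k with
  | zero => exact discreteMeasurable_const _
  | succ k ih =>
    exact ih.bind (G := fun s z => step f γ tape k
      (sched z k ((List.range s.count).map tape)).1
      (sched z k ((List.range s.count).map tape)).2 s)
      fun s => (discreteMeasurable_sched hsched k _).map fun ev => step f γ tape k ev.1 ev.2 s

theorem discreteMeasurable_readLog (hsched : ∀ k h e, MeasurableSet {z | sched z k h = e})
    (tape : ℕ → Fin n) (t : ℕ) :
    DiscreteMeasurable (fun z => readLog (run f γ x0 a0 (sched z) tape) t) := by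
  refine (discreteMeasurable_sInf
    (S := fun z => {k | t < (run f γ x0 a0 (sched z) tape k).count}) fun k => ?_).bind
    (G := fun k z => (run f γ x0 a0 (sched z) tape k).log t)
    fun k => (discreteMeasurable_run hsched tape k).map fun s => s.log t
  exact (discreteMeasurable_run hsched tape k).preimage {s | t < s.count}

/-- The sequence of all reads may take uncountably many values; its truncations do not, and the
structure of read `t` involves only reads up to `t`. -/
theorem discreteMeasurable_truncate {F : ℕ → Z → β} (hF : ∀ u, DiscreteMeasurable (F u)) (b : β)
    (m : ℕ) : DiscreteMeasurable (fun z u => if u < m then F u z else b) := by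
  induction m with
  | zero => simpa using discreteMeasurable_const (Z := Z) fun _ : ℕ => b
  | succ m ih =>
    have : (fun z u => if u < m + 1 then F u z else b) =
        fun z => Function.update (fun u => if u < m then F u z else b) m (F m z) := by
      funext z u
      rcases lt_trichotomy u m with h | h | h
      · rw [Function.update_of_ne h.ne, if_pos h, if_pos (by omega)]
      · subst h
        simp
      · rw [Function.update_of_ne h.ne', if_neg (by omega), if_neg (by omega)]
    rw [this]
    exact ih.bind (G := fun ℓ z => Function.update ℓ m (F m z)) fun ℓ =>
      (hF m).map fun c => Function.update ℓ m c

theorem StructuredAt.congr {ω ω' : ℕ → Fin n} {ℓ ℓ' : ℕ → Mem n d} {t : ℕ}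
    (h : StructuredAt f γ x0 a0 τ ω ℓ t) (hω : ∀ u < t, ω u = ω' u) (hℓ : ∀ u ≤ t, ℓ u = ℓ' u) :
    StructuredAt f γ x0 a0 τ ω' ℓ' t := by
  constructor
  · intro v
    obtain ⟨U, hU, h1, h2⟩ := h.1 v
    refine ⟨U, hU, fun u hu hv => h1 u hu (by rwa [hω u (by omega)]), ?_⟩
    rw [← hℓ t le_rfl, h2]
    congr 2
    refine sum_congr rfl fun u hu => ?_
    have := mem_range.1 (hU hu)
    rw [hℓ u this.le, hω u this]
  · intro j v
    rw [← hℓ t le_rfl]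
    rcases h.2 j v with ⟨h1, h2⟩ | ⟨u, hu, h1, h2, h3, h4⟩
    · exact Or.inl ⟨h1, fun hv r hr => by rw [← hω r (by omega)]; exact h2 hv r hr⟩
    · refine Or.inr ⟨u, hu, h1, by rw [← hω u hu]; exact h2, ?_, fun r hur hr => ?_⟩
      · rw [h3, hℓ u hu.le]
      · rw [← hω r (by omega)]
        exact h4 r hur hr

theorem measurableSet_structuredAt (hsched : ∀ k h e, MeasurableSet {z | sched z k h = e})
    (tape : ℕ → Fin n) (t : ℕ) :
    MeasurableSet {z | StructuredAt f γ x0 a0 τ tape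
      (readLog (run f γ x0 a0 (sched z) tape)) t} := by
  convert (discreteMeasurable_truncate (fun u => discreteMeasurable_readLog (f := f) (γ := γ)
    (x0 := x0) (a0 := a0) hsched tape u) 0 (t + 1)).preimage
    {ℓ | StructuredAt f γ x0 a0 τ tape ℓ t} using 1
  ext z
  simp only [Set.mem_preimage, Set.mem_ofPred_eq]
  constructor <;> intro h <;> refine h.congr (fun _ _ => rfl) fun u hu => ?_
  · rw [if_pos (by omega)]
  · rw [if_pos (by omega)]

end DiscreteRandomness

/-! ### From the probability space to means over finite sample sequences. -/

section Transfer
open MeasureTheory ProbabilityTheory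
variable {n : ℕ} {Ω Z : Type*} {i : ℕ → Ω → Fin n}

/-- The first `T` samples. -/
def firstSamples (i : ℕ → Ω → Fin n) (T : ℕ) (ω : Ω) : Fin T → Fin n := fun u => i u ω

theorem extendTape_firstSamples (j0 : Fin n) (T : ℕ) (ω : Ω) {u : ℕ} (hu : u < T) :
    extendTape j0 (firstSamples i T ω) u = i u ω := by
  simp [extendTape, firstSamples, hu]

variable [MeasurableSpace Ω] [MeasurableSpace Z] {P : Measure Ω} {hw : Ω → Z}

theorem measurable_firstSamples (hi : ∀ t, Measurable (i t)) (T : ℕ) :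
    Measurable (firstSamples i T) :=
  measurable_pi_lambda _ fun u => hi u

theorem measureReal_firstSamples
    (hunif : ∀ t j, P.real {ω | i t ω = j} = 1 / n) (hindep : iIndepFun i P) {T : ℕ}
    (w : Fin T → Fin n) : P.real (firstSamples i T ⁻¹' {w}) = 1 / (n : ℝ) ^ T := by
  have hindep' : iIndepFun (fun u : Fin T => i u) P :=
    hindep.precomp Fin.val_injective
  have h1 : firstSamples i T ⁻¹' {w} = ⋂ u ∈ (univ : Finset (Fin T)), i u ⁻¹' {w u} := by
    ext ω
    simp [firstSamples, funext_iff]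
  rw [h1, Measure.real, hindep'.measure_inter_preimage_eq_mul (sets := fun u => {w u}) univ
    fun u _ => measurableSet_singleton _, ENNReal.toReal_prod]
  have h2 : ∀ u : Fin T, (P (i u ⁻¹' {w u})).toReal = 1 / n := fun u => hunif u (w u)
  simp [h2]

theorem indepFun_firstSamples (hindep_hw : IndepFun hw (fun ω t => i t ω) P) (T : ℕ) :
    IndepFun hw (firstSamples i T) P :=
  hindep_hw.comp (φ := id) (ψ := fun tape : ℕ → Fin n => fun u : Fin T => tape u)
    measurable_id (measurable_pi_lambda _ fun _ => measurable_pi_apply _)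

/-- What holds almost surely of the hardware and of the first samples holds for almost all
hardware and for all values of the first samples. -/
theorem ae_forall_firstSamples (hn : 0 < n)
    (hunif : ∀ t j, P.real {ω | i t ω = j} = 1 / n) (hindep : iIndepFun i P)
    (hindep_hw : IndepFun hw (fun ω t => i t ω) P) {T : ℕ} {B : (Fin T → Fin n) → Set Z}
    (hB : ∀ w, MeasurableSet (B w)) (h : ∀ᵐ ω ∂P, hw ω ∈ B (firstSamples i T ω)) :
    ∀ᵐ ω ∂P, ∀ w, hw ω ∈ B w := by
  rw [ae_all_iff]
  intro w
  -- By independence, the probability of `hw ∉ B w` times that of the samples being `w` is zero, and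
  -- the latter is `1 / n ^ T > 0`.
  have h1 := (indepFun_firstSamples hindep_hw T).measure_inter_preimage_eq_mul (B w)ᶜ {w}
    (hB w).compl (measurableSet_singleton w)
  have h2 : P (hw ⁻¹' (B w)ᶜ ∩ firstSamples i T ⁻¹' {w}) = 0 := by
    refine measure_mono_null ?_ (ae_iff.1 h)
    rintro ω ⟨h3, h4⟩ h5
    rw [Set.mem_preimage, Set.mem_singleton_iff] at h4
    rw [h4] at h5
    exact h3 h5
  have h3 : P (firstSamples i T ⁻¹' {w}) ≠ 0 := by
    intro h4
    have h5 := measureReal_firstSamples hunif hindep w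
    rw [Measure.real, h4, ENNReal.toReal_zero] at h5
    have : 0 < 1 / (n : ℝ) ^ T := by positivity
    linarith
  rw [h2] at h1
  have h4 := (mul_eq_zero.1 h1.symm).resolve_right h3
  exact ae_iff.2 h4

/-- The mean over the samples and over the hardware can be computed iteratively. -/
theorem integral_eq_integral_tapeMean [IsProbabilityMeasure P] (hi : ∀ t, Measurable (i t))
    (hunif : ∀ t j, P.real {ω | i t ω = j} = 1 / n) (hindep : iIndepFun i P)
    (hindep_hw : IndepFun hw (fun ω t => i t ω) P) (j0 : Fin n) {T : ℕ}
    {Y : Z → (ℕ → Fin n) → ℝ} (hY : ∀ tape, Measurable fun z => Y z tape)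
    (hYint : ∀ w : Fin T → Fin n, Integrable (fun ω => Y (hw ω) (extendTape j0 w)) P) :
    Integrable (fun ω => Y (hw ω) (extendTape j0 (firstSamples i T ω))) P ∧
    ∫ ω, Y (hw ω) (extendTape j0 (firstSamples i T ω)) ∂P =
      ∫ ω, tapeMean j0 T (Y (hw ω)) ∂P := by
  set I : (Fin T → Fin n) → Ω → ℝ := fun w => (firstSamples i T ⁻¹' {w}).indicator 1 with hI
  have hset : ∀ w, MeasurableSet (firstSamples i T ⁻¹' {w}) := fun w =>
    measurable_firstSamples hi T (measurableSet_singleton w)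
  -- Splitting over the finitely many sample values means that `Y` need only be measurable in the
  -- hardware, for each fixed tape.
  have hsum : (fun ω => Y (hw ω) (extendTape j0 (firstSamples i T ω))) =
      fun ω => ∑ w, I w ω * Y (hw ω) (extendTape j0 w) := by
    funext ω
    rw [sum_eq_single_of_mem (firstSamples i T ω) (mem_univ _)]
    · simp [hI]
    · intro w _ hw'
      simp [hI, hw'.symm]
  have hint : ∀ w, Integrable (fun ω => I w ω * Y (hw ω) (extendTape j0 w)) P := by
    intro w
    have : (fun ω => I w ω * Y (hw ω) (extendTape j0 w)) =
        (firstSamples i T ⁻¹' {w}).indicator fun ω => Y (hw ω) (extendTape j0 w) := by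
      funext ω
      by_cases h : ω ∈ firstSamples i T ⁻¹' {w} <;> simp [hI, Set.indicator, h]
    rw [this]
    exact (hYint w).indicator (hset w)
  have hprod : ∀ w, ∫ ω, I w ω * Y (hw ω) (extendTape j0 w) ∂P =
      1 / (n : ℝ) ^ T * ∫ ω, Y (hw ω) (extendTape j0 w) ∂P := by
    intro w
    have h1 : IndepFun (I w) (fun ω => Y (hw ω) (extendTape j0 w)) P := by
      have h2 := (indepFun_firstSamples hindep_hw T).symm.comp
        (φ := fun w' => ({w} : Set (Fin T → Fin n)).indicator (fun _ => (1 : ℝ)) w')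
        (ψ := fun z => Y z (extendTape j0 w)) (measurable_of_countable _) (hY _)
      exact h2
    rw [h1.integral_fun_mul_eq_mul_integral
      ((measurable_one.indicator (hset w)).aestronglyMeasurable)
      (hYint w).aestronglyMeasurable]
    congr 1
    rw [hI, integral_indicator_one (hset w), measureReal_firstSamples hunif hindep]
  rw [hsum]
  refine ⟨integrable_finsetSum _ fun w _ => hint w, ?_⟩
  rw [integral_finsetSum _ fun w _ => hint w]
  simp only [hprod, tapeMean]
  rw [integral_const_mul, integral_finsetSum _ fun w _ => hYint w, mul_sum]

end Transfer

end Asaga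

/-! ### The convergence theorem for the machine. -/

theorem theorem2 {n d p : ℕ} (f : Fin n → Asaga.Vec d → ℝ) (L μ : ℝ) (hL : 0 < L) (hμ : 0 < μ)
    (hdiff : ∀ i, Differentiable ℝ (f i))
    (hconv : ∀ i, ConvexOn ℝ Set.univ (f i))
    (hlip : ∀ i x y, ‖gradient (f i) x - gradient (f i) y‖ ≤ L * ‖x - y‖)
    (hstrong : StrongConvexOn Set.univ μ (Asaga.objective f))
    (xstar : Asaga.Vec d) (hxstar : ∀ y, Asaga.objective f xstar ≤ Asaga.objective f y)
    (x0 : Asaga.Vec d) (a0 : Fin n → Asaga.Vec d)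
    (ha0 : ∀ i v, v ∉ Asaga.support (f i) → a0 i v = 0)
    (τ : ℕ) (hτ : (τ : ℝ) < n / 10)
    (a γ : ℝ) (ha : 0 < a) (haStar : a ≤ Asaga.aStar (L / μ) (Asaga.sparsity f) τ)
    (hγ : γ = a / L)
    {Ω Z : Type*} [MeasurableSpace Ω] [MeasurableSpace Z]
    (P : MeasureTheory.Measure Ω) [MeasureTheory.IsProbabilityMeasure P]
    -- the samples are i.i.d. uniform, and independent of the randomness `hw` of the hardware
    (i : ℕ → Ω → Fin n) (hi : ∀ t, Measurable (i t))
    (hunif : ∀ t j, P.real {ω | i t ω = j} = 1 / n)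
    (hindep : ProbabilityTheory.iIndepFun i P)
    (hw : Ω → Z) (hhw : Measurable hw)
    (hindep_hw : ProbabilityTheory.IndepFun hw (fun ω t => i t ω) P)
    -- the scheduler may use `hw` and the past samples
    (sched : Z → Asaga.Scheduler n d p)
    (hsched : ∀ k h e, MeasurableSet {z | sched z k h = e})
    (R : Ω → ℕ → Asaga.State n d p)
    (hR : ∀ ω, R ω = Asaga.run f γ x0 a0 (sched (hw ω)) (fun t => i t ω))
    (hlive : ∀ᵐ ω ∂P, Asaga.Unending (R ω))
    (hoverlap : ∀ᵐ ω ∂P, Asaga.BoundedOverlaps τ (R ω)) :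
    ∀ t : ℕ,
      MeasureTheory.Integrable (fun ω => Asaga.objective f (Asaga.readIterate (R ω) t)) P ∧
      (∫ ω, Asaga.objective f (Asaga.readIterate (R ω) t) ∂P) - Asaga.objective f xstar ≤
        (1 - Asaga.rate n (L / μ) a) ^ t *
          (60 * (n / γ) * Asaga.initialError f L x0 a0 xstar) := by
  
  intro t
  have hn : 0 < n := by
    have h1 : (0 : ℝ) < n / 10 := lt_of_le_of_lt (Nat.cast_nonneg τ) hτ
    have h2 : (0 : ℝ) < n := by linarith
    exact_mod_cast h2
  set j0 : Fin n := ⟨0, hn⟩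
  -- The horizon includes sample `t` itself, over which the estimates for index `t` average.
  set T := t + 1
  have hf : Asaga.SmoothProblem f L μ xstar :=
    ⟨hL, hμ, hdiff, hconv, hlip, hstrong, hxstar⟩
  set X : Z → (ℕ → Fin n) → ℕ → Asaga.Mem n d := fun z tape =>
    Asaga.readLog (Asaga.run f γ x0 a0 (sched z) tape) with hX
  have hread : ∀ ω, Asaga.readLog (R ω) = X (hw ω) (fun u => i u ω) := fun ω => by rw [hR]
  have hcausal : ∀ ω, ∀ s ≤ T, X (hw ω) (fun u => i u ω) s =
      X (hw ω) (Asaga.extendTape j0 (Asaga.firstSamples i T ω)) s := fun ω s hs =>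
    Asaga.readLog_run_causal _ fun u hu =>
      (Asaga.extendTape_firstSamples j0 T ω (hu.trans_le hs)).symm
  have hstruct : ∀ᵐ ω ∂P, ∀ s < T, Asaga.StructuredAt f γ x0 a0 τ
      (Asaga.extendTape j0 (Asaga.firstSamples i T ω))
      (X (hw ω) (Asaga.extendTape j0 (Asaga.firstSamples i T ω))) s := by
    filter_upwards [hlive, hoverlap] with ω h1 h2 s hs
    obtain ⟨l, hl⟩ := h1 s
    have hexec : Asaga.IsExecution f γ x0 a0 (fun u => i u ω) (R ω) := by
      rw [hR]
      exact Asaga.isExecution_run _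
    refine (hexec.structuredAt h2 hl).congr (fun u hu =>
      (Asaga.extendTape_firstSamples j0 T ω (hu.trans hs)).symm) fun u hu => ?_
    rw [hread]
    exact hcausal ω u (hu.trans hs.le)
  have hproc : ∀ᵐ ω ∂P, Asaga.AsyncProcess f γ x0 a0 τ T j0 (X (hw ω)) := by
    have h1 : ∀ w : Fin T → Fin n, MeasurableSet {z | ∀ s < T,
        Asaga.StructuredAt f γ x0 a0 τ (Asaga.extendTape j0 w) (X z (Asaga.extendTape j0 w)) s} := by
      intro w
      have h2 : {z | ∀ s < T, Asaga.StructuredAt f γ x0 a0 τ (Asaga.extendTape j0 w)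
          (X z (Asaga.extendTape j0 w)) s} = ⋂ s ∈ Set.Iio T, {z | Asaga.StructuredAt f γ x0 a0 τ
          (Asaga.extendTape j0 w) (X z (Asaga.extendTape j0 w)) s} := by
        ext z
        simp
      rw [h2]
      exact MeasurableSet.biInter (Set.to_countable _) fun s _ =>
        Asaga.measurableSet_structuredAt hsched _ s
    filter_upwards [Asaga.ae_forall_firstSamples hn hunif hindep hindep_hw h1 hstruct] with ω h
    exact ⟨fun tape tape' s h' => Asaga.readLog_run_causal _ h', h⟩
  set C := (1 - Asaga.rate n (L / μ) a) ^ t *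
    (60 * (n / γ) * Asaga.initialError f L x0 a0 xstar) with hC
  have hmean : ∀ᵐ ω ∂P, Asaga.meanGap f xstar j0 T (X (hw ω)) t ≤ C := by
    filter_upwards [hproc] with ω h
    exact h.meanGap_le hf ha0 hτ ha haStar hγ t.lt_succ_self
  set Y : Z → (ℕ → Fin n) → ℝ := fun z tape =>
    Asaga.objective f (X z tape t).x - Asaga.objective f xstar with hYdef
  have hY0 : ∀ z tape, 0 ≤ Y z tape := fun z tape => sub_nonneg.2 (hxstar _)
  have hYmeas : ∀ tape, Measurable fun z => Y z tape := fun tape =>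
    ((Asaga.discreteMeasurable_readLog (f := f) (γ := γ) (x0 := x0) (a0 := a0) hsched tape t).map
      fun m => Asaga.objective f m.x - Asaga.objective f xstar).measurable
  have hYint : ∀ w : Fin T → Fin n,
      MeasureTheory.Integrable (fun ω => Y (hw ω) (Asaga.extendTape j0 w)) P := by
    intro w
    refine MeasureTheory.Integrable.of_bound
      ((hYmeas _).comp hhw).aestronglyMeasurable ((n : ℝ) ^ T * C) ?_
    filter_upwards [hmean] with ω h
    rw [Real.norm_of_nonneg (hY0 _ _)]
    -- Integrability comes from the convergence bound itself: the gaps are nonnegative and their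
    -- mean over the `n ^ T` tapes is at most `C`, so each of them is at most `n ^ T * C`.
    have h1 : ∑ w : Fin T → Fin n, Y (hw ω) (Asaga.extendTape j0 w) ≤ (n : ℝ) ^ T * C := by
      rw [Asaga.meanGap, Asaga.tapeMean, one_div, inv_mul_le_iff₀ (by positivity)] at h
      exact h
    exact (Finset.single_le_sum (f := fun w : Fin T → Fin n => Y (hw ω) (Asaga.extendTape j0 w))
      (fun w _ => hY0 _ _) (Finset.mem_univ w)).trans h1
  obtain ⟨hint, heq⟩ := Asaga.integral_eq_integral_tapeMean hi hunif hindep hindep_hw j0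
    hYmeas hYint
  have hgap : (fun ω => Asaga.objective f (Asaga.readIterate (R ω) t)) = fun ω =>
      Y (hw ω) (Asaga.extendTape j0 (Asaga.firstSamples i T ω)) + Asaga.objective f xstar := by
    funext ω
    have h1 : Asaga.readIterate (R ω) t = (Asaga.readLog (R ω) t).x := rfl
    rw [h1, hread, hcausal ω t t.le_succ, hYdef]
    simp only [sub_add_cancel]
  rw [hgap]
  refine ⟨hint.add (MeasureTheory.integrable_const _), ?_⟩
  rw [MeasureTheory.integral_add hint (MeasureTheory.integrable_const _), heq]
  have hCint : ∫ ω, Asaga.tapeMean j0 T (Y (hw ω)) ∂P ≤ ∫ _, C ∂P := by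
    refine MeasureTheory.integral_mono_ae ?_ (MeasureTheory.integrable_const _) hmean
    simp only [Asaga.tapeMean]
    exact (MeasureTheory.integrable_finsetSum _ fun w _ => hYint w).const_mul _
  simp only [MeasureTheory.integral_const, MeasureTheory.probReal_univ, one_smul] at hCint ⊢
  linarith
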